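/- Consider three bodies in $\mathbb{R}^3$ with masses $m_1,m_2,m_3>0$ and charges $Q_1,Q_2,Q_3\in\mathbb{R}$, with Hamiltonian $$H(q,p)=\sum_i\frac{\|p_i\|^2}{2m_i}+V(q),\qquad V(q)=\sum_{i<j}\frac{Q_iQ_j}{\|q_i-q_j\|},$$ on the phase space of pairs $(q,p)$ with $q_1,q_2,q_3$ pairwise distinct. Put $m=\sum_i m_i$ and $C(q)=\frac1m\sum_i m_iq_i$. A *central configuration* is a collision-free $q$ for which there is a multiplier $\lambda\in\mathbb{R}$ with $\partial_{q_i}V=\lambda m_i\,(q_i-C(q))$ for $i=1,2,3$. The integral map is $\mathcal F=(H,L,P,C)$ with $L=\sum_i q_i\times p_i$ and $P=\sum_i p_i$; a *critical point* is a phase point with $P=0$, $C=0$ at which $D\mathcal F$ does not have full rank $10$. It is a *relative equilibrium* if it is not an equilibrium and the Hamiltonian vector field $X_H$ agrees there with $X_{\langle\xi,L\rangle}$ for some $\xi\in\mathbb{R}^3$. A critical point $(q,p)$ is *associated to the central configuration* $q$ if it is a relative equilibrium and $q$ is a central configuration. Phase points are counted up to similarity, i.e. up to rotations $(q_i,p_i)\mapsto(Rq_i,Rp_i)$,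 $R\in SO(3)$, and dilations $(q,p)\mapsto(c^2q,c^{-1}p)$, $c>0$. Let the masses $m_1,m_2,m_3>0$ be given. Then: 1. For all charges, the number of similarity classes of critical points associated to collinear central configurations is $0$, $1$, $2$ or $3$. 2. Each of the numbers $0,1,2,3$ occurs for suitable non-zero charges. 3. For all charges, there are no critical points associated to non-collinear central configurations. 4. If at least two charges are non-zero, every multiplier of a non-collinear central configuration is negative, and no critical point of $\mathcal F$ of any kind projects to a non-collinear central configuration. -/

import Mathlib

open scoped InnerProductSpace

noncomputable section

namespace ThreeBody

/-- Euclidean three-space. -/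
abbrev Space : Type := EuclideanSpace ℝ (Fin 3)

/-- Positions (or momenta) of three labelled bodies. -/
abbrev Config : Type := Fin 3 → Space

/-- Pairs `(q, p)` of positions and momenta. -/
abbrev Phase : Type := Config × Config

/-- The vector product on Euclidean three-space. -/
def cross (a b : Space) : Space := WithLp.toLp 2 (crossProduct a.ofLp b.ofLp)

/-- The complement of the collision set. -/
def CollisionFree (q : Config) : Prop := ∀ i j, i ≠ j → q i ≠ q j

/-- The potential `∑_{i<j} -γ_{ij} / ‖q_i - q_j‖` with the electrostatic coefficients
`γ_{ij} = -Q_i Q_j`, where `Q_i` is the charge of the `i`-th body. -/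
def potential (Q : Fin 3 → ℝ) (q : Config) : ℝ :=
  ∑ i, ∑ j ∈ Finset.Ioi i, -(-(Q i * Q j)) / ‖q i - q j‖

/-- The gradient of a function on configuration space with respect to the position of
the `i`-th body. -/
def partialGradient (f : Config → ℝ) (q : Config) (i : Fin 3) : Space :=
  gradient (fun x => f (Function.update q i x)) (q i)

/-- The centre of mass. -/
def centerOfMass (m : Fin 3 → ℝ) (q : Config) : Space := (∑ i, m i)⁻¹ • ∑ i, m i • q i

/-- `q` is a central configuration with multiplier `lam`. -/
def IsCentralWith (m Q : Fin 3 → ℝ) (q : Config) (lam : ℝ) : Prop :=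
  CollisionFree q ∧
    ∀ i, partialGradient (potential Q) q i = (lam * m i) • (q i - centerOfMass m q)

/-- `q` is a central configuration. -/
def IsCentral (m Q : Fin 3 → ℝ) (q : Config) : Prop := ∃ lam : ℝ, IsCentralWith m Q q lam

/-- The three bodies lie on a line. -/
def IsCollinear (q : Config) : Prop := Collinear ℝ (Set.range q)

/-- The Hamiltonian, kinetic plus potential energy. -/
def hamiltonian (m Q : Fin 3 → ℝ) (z : Phase) : ℝ :=
  ∑ i, ‖z.2 i‖ ^ 2 / (2 * m i) + potential Q z.1

/-- Total angular momentum. -/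
def angularMomentum (z : Phase) : Space := ∑ i, cross (z.1 i) (z.2 i)

/-- Total momentum. -/
def totalMomentum (z : Phase) : Space := ∑ i, z.2 i

/-- The integral map `(H, L, P, Q)` with values in a ten-dimensional space: energy, angular
momentum, momentum and centre of mass. -/
def integralMap (m Q : Fin 3 → ℝ) (z : Phase) : ℝ × Space × Space × Space :=
  (hamiltonian m Q z, angularMomentum z, totalMomentum z, centerOfMass m z.1)

/-- Critical points of the integral map: points of phase space (with centre of mass and total
momentum equal to zero) at which the derivative of the integral map does not have full rank. -/
def IsCriticalPoint (m Q : Fin 3 → ℝ) (z : Phase) : Prop :=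
  CollisionFree z.1 ∧ centerOfMass m z.1 = 0 ∧ totalMomentum z = 0 ∧
    ¬ Function.Surjective (fderiv ℝ (integralMap m Q) z)

/-- The Hamiltonian vector field `(∂F/∂p, -∂F/∂q)` of a function `F` on phase space. -/
def hamiltonianVectorField (F : Phase → ℝ) (z : Phase) : Phase :=
  (fun i => partialGradient (fun p => F (z.1, p)) z.2 i,
   fun i => -partialGradient (fun q => F (q, z.2)) z.1 i)

/-- Relative equilibria with respect to the rotation group: the vector field of the Hamiltonian
agrees at `z` with the vector field of a component `⟨ξ, L⟩` of angular momentum, that is, with an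
infinitesimal rotation, and `z` is not an equilibrium. -/
def IsRelativeEquilibrium (m Q : Fin 3 → ℝ) (z : Phase) : Prop :=
  hamiltonianVectorField (hamiltonian m Q) z ≠ 0 ∧
    ∃ ξ : Space, hamiltonianVectorField (hamiltonian m Q) z =
      hamiltonianVectorField (fun w => ⟪ξ, angularMomentum w⟫_ℝ) z

/-- `z = (q, p)` is a critical point associated to a central configuration: a critical point of the
integral map which is a relative equilibrium and projects to the central configuration `q`. -/
def IsAssociatedToCentral (m Q : Fin 3 → ℝ) (z : Phase) : Prop :=
  IsCriticalPoint m Q z ∧ IsRelativeEquilibrium m Q z ∧ IsCentral m Q z.1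

/-- Two phase points are similar if one is obtained from the other by a rotation, acting on
positions and momenta alike, and a dilation `(q, p) ↦ (c² q, c⁻¹ p)`. -/
def Similar (z w : Phase) : Prop :=
  ∃ (R : Space ≃ₗᵢ[ℝ] Space) (c : ℝ),
    LinearMap.det (R.toLinearEquiv : Space →ₗ[ℝ] Space) = 1 ∧ 0 < c ∧
      (∀ i, w.1 i = c ^ 2 • R (z.1 i)) ∧ (∀ i, w.2 i = c⁻¹ • R (z.2 i))

theorem Similar.refl (z : Phase) : Similar z z := by
  refine ⟨LinearIsometryEquiv.refl ℝ Space, 1, ?_, one_pos, by simp, by simp⟩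
  exact LinearMap.det_id

theorem Similar.symm {z w : Phase} (h : Similar z w) : Similar w z := by
  obtain ⟨R, c, hR, hc, h1, h2⟩ := h
  refine ⟨R.symm, c⁻¹, ?_, inv_pos.mpr hc, fun i => ?_, fun i => ?_⟩
  · have h := LinearEquiv.det_mul_det_symm R.toLinearEquiv
    rw [hR, one_mul] at h
    exact h
  · rw [h1 i, map_smul, R.symm_apply_apply, smul_smul, inv_pow,
      inv_mul_cancel₀ (pow_ne_zero 2 hc.ne'), one_smul]
  · rw [h2 i, map_smul, R.symm_apply_apply, smul_smul, inv_inv,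
      mul_inv_cancel₀ hc.ne', one_smul]

theorem Similar.trans {z w v : Phase} (h : Similar z w) (h' : Similar w v) : Similar z v := by
  obtain ⟨R, c, hR, hc, h1, h2⟩ := h
  obtain ⟨S, d, hS, hd, h3, h4⟩ := h'
  refine ⟨R.trans S, d * c, ?_, mul_pos hd hc, fun i => ?_, fun i => ?_⟩
  · have h : ((R.trans S).toLinearEquiv : Space →ₗ[ℝ] Space) =
        (S.toLinearEquiv : Space →ₗ[ℝ] Space) ∘ₗ (R.toLinearEquiv : Space →ₗ[ℝ] Space) := rfl
    rw [h, LinearMap.det_comp, hS, hR, one_mul]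
  · rw [h3 i, h1 i, map_smul, smul_smul, mul_pow, LinearIsometryEquiv.trans_apply]
  · rw [h4 i, h2 i, map_smul, smul_smul, mul_inv, LinearIsometryEquiv.trans_apply]

/-- Similarity of phase points as an equivalence relation. -/
def similarity : Setoid Phase := ⟨Similar, Similar.refl, Similar.symm, Similar.trans⟩

/-- The similarity classes of critical points associated to collinear central configurations. -/
def collinearClasses (m Q : Fin 3 → ℝ) : Set (Quotient similarity) :=
  Quotient.mk similarity '' {z | IsAssociatedToCentral m Q z ∧ IsCollinear z.1}

end ThreeBody

end

open scoped InnerProductSpace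

noncomputable section

namespace ThreeBody

/-! ### The vector product -/

/-! Where the derivative of the integral map drops rank, a non-zero functional kills its range. Its
components are Lagrange multipliers, and those of `P` and `C` vanish because the point is centred.
If the multiplier of `H` also vanishes, all positions are parallel to one vector; otherwise the
three bodies rotate uniformly with some angular velocity `ξ`
(`IsCriticalPoint.isCollinear_or_isRotating`).

For a non-collinear central configuration, comparing coefficients of two independent differences
gives `Q i * Q j = -lam * (positive)` for each pair (`IsCentralWith.charge_mul_charge`). Three
numbers cannot have pairwise opposite signs, so `lam ≤ 0`, strictly if two charges are non-zero.
Uniform rotation, on the other hand, forces `lam = ⟪ξ, ξ⟫` (`IsRotating.multiplier_eq`). These two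
facts exclude all non-collinear cases.

In the collinear case `ξ` is orthogonal to the line and the problem becomes the scalar system
`IsEuler`. Up to similarity a solution is a middle body together with a ratio `t > 0` of distances,
and the admissible `t` are the zeros of Euler's quintic subject to a sign condition
(`encard_collinearClasses_eq_add`). If the outer bodies do not attract each other, monotonicity
leaves at most one `t`. If one charge `k` is opposite to both others and sits at an end, the quintic
divided by `t ^ 2` is strictly convex, which leaves at most two. Moreover only the like-charged body
with the smaller charge-to-mass ratio can then be in the middle (`IsEulerRatio.mul_lt_mul`), so the
total is at most `1 + 2`. Without such a `k`, only a neutral body can be in the middle, and there is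
at most one class.

To realise all the numbers, body `0` is made opposite to the others. It occurs in the middle exactly
once, and a one-parameter family of quintics `U + b * W` supplies `0`, `1` or `2` further ratios
(`exists_encard_eulerRatio`). Equal charges give no class at all. -/

theorem cross_zero_coord (a b : Space) : cross a b 0 = a 1 * b 2 - a 2 * b 1 := by
  simp [cross, cross_apply]

theorem cross_one_coord (a b : Space) : cross a b 1 = a 2 * b 0 - a 0 * b 2 := by
  simp [cross, cross_apply]

theorem cross_two_coord (a b : Space) : cross a b 2 = a 0 * b 1 - a 1 * b 0 := by
  simp [cross, cross_apply]

theorem inner_eq_coord (a b : Space) : ⟪a, b⟫_ℝ = a 0 * b 0 + a 1 * b 1 + a 2 * b 2 := by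
  simp [PiLp.inner_apply, Fin.sum_univ_three, mul_comm]

theorem Space.ext_coord {a b : Space} (h0 : a 0 = b 0) (h1 : a 1 = b 1) (h2 : a 2 = b 2) :
    a = b := by
  ext i; fin_cases i <;> assumption

theorem inner_cross_left (l a b : Space) : ⟪l, cross a b⟫_ℝ = ⟪cross l a, b⟫_ℝ := by
  simp only [inner_eq_coord, cross_zero_coord, cross_one_coord, cross_two_coord]; ring

theorem inner_cross_right (l a b : Space) : ⟪l, cross a b⟫_ℝ = ⟪cross b l, a⟫_ℝ := by
  simp only [inner_eq_coord, cross_zero_coord, cross_one_coord, cross_two_coord]; ring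

theorem cross_cross_self (a b : Space) :
    cross (cross a b) a = ⟪a, a⟫_ℝ • b - ⟪a, b⟫_ℝ • a := by
  apply Space.ext_coord <;>
  simp only [inner_eq_coord, cross_zero_coord, cross_one_coord, cross_two_coord, PiLp.sub_apply,
    PiLp.smul_apply, smul_eq_mul] <;> ring

theorem cross_smul_left (c : ℝ) (a b : Space) : cross (c • a) b = c • cross a b := by
  apply Space.ext_coord <;>
  simp only [cross_zero_coord, cross_one_coord, cross_two_coord, PiLp.smul_apply, smul_eq_mul] <;>
  ring

theorem cross_smul_right (c : ℝ) (a b : Space) : cross a (c • b) = c • cross a b := by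
  apply Space.ext_coord <;>
  simp only [cross_zero_coord, cross_one_coord, cross_two_coord, PiLp.smul_apply, smul_eq_mul] <;>
  ring

theorem cross_add_left (a b c : Space) : cross (a + b) c = cross a c + cross b c := by
  apply Space.ext_coord <;>
  simp only [cross_zero_coord, cross_one_coord, cross_two_coord, PiLp.add_apply] <;>
  ring

theorem cross_add_right (a b c : Space) : cross a (b + c) = cross a b + cross a c := by
  apply Space.ext_coord <;>
  simp only [cross_zero_coord, cross_one_coord, cross_two_coord, PiLp.add_apply] <;>
  ring

theorem cross_zero_right (a : Space) : cross a 0 = 0 := by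
  simpa using cross_smul_right 0 a 0

theorem cross_zero_left (a : Space) : cross 0 a = 0 := by
  simpa using cross_smul_left 0 0 a

/-- The vector product as a continuous bilinear map. -/
def crossL : Space →L[ℝ] Space →L[ℝ] Space :=
  (LinearMap.mk₂ ℝ cross cross_add_left cross_smul_left cross_add_right
    cross_smul_right).toContinuousBilinearMap

theorem crossL_apply (a b : Space) : crossL a b = cross a b := rfl

/-- A vector whose vector product with `l ≠ 0` vanishes is a multiple of `l`. -/
theorem exists_smul_eq_of_cross_eq_zero {l a : Space} (hl : l ≠ 0) (h : cross l a = 0) :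
    ∃ r : ℝ, a = r • l := by
  have h1 := cross_cross_self l a
  rw [h, cross_zero_left] at h1
  have h2 : ⟪l, l⟫_ℝ ≠ 0 := inner_self_ne_zero.mpr hl
  refine ⟨⟪l, a⟫_ℝ / ⟪l, l⟫_ℝ, ?_⟩
  rw [div_eq_inv_mul, mul_smul, ← sub_eq_zero.mp h1.symm, smul_smul, inv_mul_cancel₀ h2, one_smul]

/-! ### Derivatives of the integrals -/

/-- The gradient of the potential with respect to the position of the `i`-th body. -/
def potentialGradient (Q : Fin 3 → ℝ) (q : Config) (i : Fin 3) : Space :=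
  -∑ j, (Q i * Q j / ‖q i - q j‖ ^ 3) • (q i - q j)

/-- The linear form on configurations with given partial gradients. -/
def formOf (G : Config) : Config →L[ℝ] ℝ :=
  ∑ i, (innerSL ℝ (G i)).comp (ContinuousLinearMap.proj (R := ℝ) (φ := fun _ : Fin 3 => Space) i)

theorem formOf_apply (G v : Config) : formOf G v = ∑ i, ⟪G i, v i⟫_ℝ := by
  simp [formOf]

/-- Chain rule along `Function.update`: every partial gradient in the definitions can thus be read
off from one Fréchet derivative. -/
theorem partialGradient_eq_of_hasFDerivAt {f : Config → ℝ} {q G : Config}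
    (h : HasFDerivAt f (formOf G) q) (i : Fin 3) : partialGradient f q i = G i := by
  have h1 : HasFDerivAt (fun x => Function.update q i x)
      (ContinuousLinearMap.pi (Pi.single i (ContinuousLinearMap.id ℝ Space))) (q i) :=
    hasFDerivAt_update q (q i)
  have h2 : HasFDerivAt f (formOf G) (Function.update q i (q i)) := by
    rwa [Function.update_eq_self]
  have h3 := h2.comp (q i) h1
  apply HasGradientAt.gradient
  rw [hasGradientAt_iff_hasFDerivAt]
  refine h3.congr_fderiv ?_
  ext v
  simp only [InnerProductSpace.toDual_apply_apply, ContinuousLinearMap.comp_apply, formOf_apply,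
    ContinuousLinearMap.pi_apply]
  rw [Finset.sum_eq_single i]
  · simp
  · intro j _ hj; simp [Pi.single_eq_of_ne hj]
  · simp

theorem hasFDerivAt_inv_norm {x : Space} (hx : x ≠ 0) :
    HasFDerivAt (fun y : Space => ‖y‖⁻¹) (-(‖x‖ ^ 3)⁻¹ • innerSL ℝ x) x := by
  have hx' : ‖x‖ ≠ 0 := norm_ne_zero_iff.mpr hx
  have h1 := (hasStrictFDerivAt_norm_sq x).hasFDerivAt.sqrt (pow_ne_zero 2 hx')
  simp only [Real.sqrt_sq (norm_nonneg _)] at h1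
  have h2 := (hasDerivAt_inv hx').comp_hasFDerivAt x h1
  refine h2.congr_fderiv ?_
  ext v
  simp
  field_simp

theorem hasFDerivAt_pair (a : ℝ) {q : Config} {i j : Fin 3} (h : q i ≠ q j) :
    HasFDerivAt (fun q : Config => -(-a) / ‖q i - q j‖)
      ((-(a / ‖q i - q j‖ ^ 3)) • (innerSL ℝ (q i - q j)).comp
        (ContinuousLinearMap.proj (R := ℝ) (φ := fun _ : Fin 3 => Space) i -
          ContinuousLinearMap.proj (R := ℝ) (φ := fun _ : Fin 3 => Space) j)) q := by
  have h1 : HasFDerivAt (fun q : Config => q i - q j)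
      (ContinuousLinearMap.proj (R := ℝ) (φ := fun _ : Fin 3 => Space) i -
          ContinuousLinearMap.proj (R := ℝ) (φ := fun _ : Fin 3 => Space) j) q :=
    (hasFDerivAt_apply i q).sub (hasFDerivAt_apply j q)
  have h2 := ((hasFDerivAt_inv_norm (sub_ne_zero.mpr h)).comp q h1).const_mul a
  have e : (fun q : Config => -(-a) / ‖q i - q j‖) = fun q : Config => a * ‖q i - q j‖⁻¹ := by
    funext q; rw [neg_neg, div_eq_mul_inv]
  rw [e]
  refine h2.congr_fderiv ?_
  ext v; simp; ring

theorem hasFDerivAt_potential (Q : Fin 3 → ℝ) {q : Config} (h : CollisionFree q) :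
    HasFDerivAt (potential Q) (formOf (potentialGradient Q q)) q := by
  have h01 := hasFDerivAt_pair (Q 0 * Q 1) (h 0 1 (by decide))
  have h02 := hasFDerivAt_pair (Q 0 * Q 2) (h 0 2 (by decide))
  have h12 := hasFDerivAt_pair (Q 1 * Q 2) (h 1 2 (by decide))
  have h' := (h01.add h02).add h12
  refine HasFDerivAt.congr_fderiv (f' := _) (h'.congr_of_eventuallyEq (.of_forall fun q => ?_)) ?_
  · have e0 : Finset.Ioi (0 : Fin 3) = {1, 2} := by decide
    have e1 : Finset.Ioi (1 : Fin 3) = {2} := by decide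
    have e2 : Finset.Ioi (2 : Fin 3) = ∅ := by decide
    simp [potential, Fin.sum_univ_three, e0, e1, e2]
  · ext v
    simp only [formOf_apply, potentialGradient, Fin.sum_univ_three, add_apply,
      smul_apply, ContinuousLinearMap.comp_apply, innerSL_apply_apply,
      sub_apply, ContinuousLinearMap.proj_apply, inner_neg_left,
      inner_add_left, inner_smul_left, norm_sub_rev (q 1) (q 0), norm_sub_rev (q 2) (q 0),
      norm_sub_rev (q 2) (q 1), inner_sub_left, inner_sub_right, smul_eq_mul, sub_self,
      conj_trivial]
    ring

theorem partialGradient_potential (Q : Fin 3 → ℝ) {q : Config} (h : CollisionFree q) (i : Fin 3) :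
    partialGradient (potential Q) q i = potentialGradient Q q i :=
  partialGradient_eq_of_hasFDerivAt (hasFDerivAt_potential Q h) i

theorem sum_potentialGradient (Q : Fin 3 → ℝ) (q : Config) : ∑ i, potentialGradient Q q i = 0 := by
  simp only [potentialGradient, Fin.sum_univ_three, norm_sub_rev (q 1) (q 0),
    norm_sub_rev (q 2) (q 0), norm_sub_rev (q 2) (q 1), mul_comm (Q 1) (Q 0), mul_comm (Q 2) (Q 0),
    mul_comm (Q 2) (Q 1)]
  module

theorem hasFDerivAt_kinetic (m : Fin 3 → ℝ) (p : Config) :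
    HasFDerivAt (fun p : Config => ∑ i, ‖p i‖ ^ 2 / (2 * m i))
      (formOf fun i => (m i)⁻¹ • p i) p := by
  have h : ∀ i, HasFDerivAt (fun p : Config => ‖p i‖ ^ 2 / (2 * m i)) _ p := fun i =>
    HasFDerivAt.mul_const (c := fun p : Config => ‖p i‖ ^ 2)
      ((hasStrictFDerivAt_norm_sq (p i)).hasFDerivAt.comp (g := fun x : Space => ‖x‖ ^ 2) p
      (hasFDerivAt_apply i p)) (2 * m i)⁻¹
  have h1 := HasFDerivAt.fun_sum (u := Finset.univ) fun i _ => h i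
  refine h1.congr_fderiv ?_
  ext v
  simp [formOf_apply, inner_smul_left]
  refine Finset.sum_congr rfl fun i _ => ?_
  ring

theorem hasFDerivAt_hamiltonian (m Q : Fin 3 → ℝ) {z : Phase} (h : CollisionFree z.1) :
    HasFDerivAt (hamiltonian m Q)
      ((formOf fun i => (m i)⁻¹ • z.2 i).comp (ContinuousLinearMap.snd ℝ Config Config) +
        (formOf (potentialGradient Q z.1)).comp (ContinuousLinearMap.fst ℝ Config Config)) z :=
  ((hasFDerivAt_kinetic m z.2).comp z hasFDerivAt_snd).add
    ((hasFDerivAt_potential Q h).comp z hasFDerivAt_fst)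

/-- The derivative of total angular momentum. -/
def angularMomentumDeriv (z : Phase) : Phase →L[ℝ] Space :=
  ∑ i, ((crossL (z.1 i)).comp
      ((ContinuousLinearMap.proj (R := ℝ) (φ := fun _ : Fin 3 => Space) i).comp
        (ContinuousLinearMap.snd ℝ Config Config)) +
    (crossL.flip (z.2 i)).comp
      ((ContinuousLinearMap.proj (R := ℝ) (φ := fun _ : Fin 3 => Space) i).comp
        (ContinuousLinearMap.fst ℝ Config Config)))

theorem angularMomentumDeriv_apply (z v : Phase) :
    angularMomentumDeriv z v = ∑ i, (cross (z.1 i) (v.2 i) + cross (v.1 i) (z.2 i)) := by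
  simp [angularMomentumDeriv, crossL_apply]

theorem hasFDerivAt_angularMomentum (z : Phase) :
    HasFDerivAt angularMomentum (angularMomentumDeriv z) z := by
  refine HasFDerivAt.fun_sum fun i _ => ?_
  have h1 : HasFDerivAt (fun z : Phase => z.1 i)
      ((ContinuousLinearMap.proj (R := ℝ) (φ := fun _ : Fin 3 => Space) i).comp
        (ContinuousLinearMap.fst ℝ Config Config)) z :=
    HasFDerivAt.comp (g := fun q : Config => q i) (f := Prod.fst) z (hasFDerivAt_apply i z.1)
      hasFDerivAt_fst
  have h2 : HasFDerivAt (fun z : Phase => z.2 i)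
      ((ContinuousLinearMap.proj (R := ℝ) (φ := fun _ : Fin 3 => Space) i).comp
        (ContinuousLinearMap.snd ℝ Config Config)) z :=
    HasFDerivAt.comp (g := fun q : Config => q i) (f := Prod.snd) z (hasFDerivAt_apply i z.2)
      hasFDerivAt_snd
  exact crossL.hasFDerivAt_of_bilinear h1 h2

/-- The derivative of total momentum. -/
def totalMomentumDeriv : Phase →L[ℝ] Space :=
  ∑ i, (ContinuousLinearMap.proj (R := ℝ) (φ := fun _ : Fin 3 => Space) i).comp
        (ContinuousLinearMap.snd ℝ Config Config)

/-- The derivative of the centre of mass. -/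
def centerOfMassDeriv (m : Fin 3 → ℝ) : Phase →L[ℝ] Space :=
  (∑ i, m i)⁻¹ • ∑ i, m i •
    (ContinuousLinearMap.proj (R := ℝ) (φ := fun _ : Fin 3 => Space) i).comp
        (ContinuousLinearMap.fst ℝ Config Config)

theorem totalMomentumDeriv_apply (v : Phase) : totalMomentumDeriv v = totalMomentum v := by
  simp [totalMomentumDeriv, totalMomentum]

theorem centerOfMassDeriv_apply (m : Fin 3 → ℝ) (v : Phase) :
    centerOfMassDeriv m v = centerOfMass m v.1 := by
  simp [centerOfMassDeriv, centerOfMass]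

theorem hasFDerivAt_totalMomentum (z : Phase) :
    HasFDerivAt totalMomentum totalMomentumDeriv z := by
  have h := totalMomentumDeriv.hasFDerivAt (x := z)
  rwa [funext totalMomentumDeriv_apply] at h

theorem hasFDerivAt_centerOfMass (m : Fin 3 → ℝ) (z : Phase) :
    HasFDerivAt (fun z : Phase => centerOfMass m z.1) (centerOfMassDeriv m) z := by
  have h := (centerOfMassDeriv m).hasFDerivAt (x := z)
  rwa [funext (centerOfMassDeriv_apply m)] at h

theorem fderiv_integralMap_apply (m Q : Fin 3 → ℝ) {z : Phase} (h : CollisionFree z.1)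
    (v : Phase) :
    fderiv ℝ (integralMap m Q) z v =
      ((∑ i, ⟪(m i)⁻¹ • z.2 i, v.2 i⟫_ℝ) + ∑ i, ⟪potentialGradient Q z.1 i, v.1 i⟫_ℝ,
        ∑ i, (cross (z.1 i) (v.2 i) + cross (v.1 i) (z.2 i)),
        totalMomentum v, centerOfMass m v.1) := by
  have h1 := (hasFDerivAt_hamiltonian m Q h).prodMk ((hasFDerivAt_angularMomentum z).prodMk
    ((hasFDerivAt_totalMomentum z).prodMk (hasFDerivAt_centerOfMass m z)))
  have h2 : HasFDerivAt (integralMap m Q) _ z := h1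
  rw [h2.fderiv]
  simp [formOf_apply, angularMomentumDeriv_apply, totalMomentumDeriv_apply,
    centerOfMassDeriv_apply]

/-! ### Hamiltonian vector fields -/

theorem hamiltonianVectorField_hamiltonian (m Q : Fin 3 → ℝ) {z : Phase}
    (h : CollisionFree z.1) :
    hamiltonianVectorField (hamiltonian m Q) z =
      (fun i => (m i)⁻¹ • z.2 i, fun i => -potentialGradient Q z.1 i) := by
  refine Prod.ext (funext fun i => ?_) (funext fun i => congrArg Neg.neg ?_)
  · exact partialGradient_eq_of_hasFDerivAt (f := fun p => hamiltonian m Q (z.1, p))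
      (G := fun i => (m i)⁻¹ • z.2 i)
      ((hasFDerivAt_kinetic m z.2).add_const (potential Q z.1)) i
  · exact partialGradient_eq_of_hasFDerivAt (f := fun q => hamiltonian m Q (q, z.2))
      (G := potentialGradient Q z.1)
      ((hasFDerivAt_potential Q h).const_add (∑ i, ‖z.2 i‖ ^ 2 / (2 * m i))) i

theorem hamiltonianVectorField_angularMomentum (ξ : Space) (z : Phase) :
    hamiltonianVectorField (fun w => ⟪ξ, angularMomentum w⟫_ℝ) z =
      (fun i => cross ξ (z.1 i), fun i => -cross (z.2 i) ξ) := by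
  have e1 : (fun p : Config => ⟪ξ, angularMomentum (z.1, p)⟫_ℝ) =
      formOf fun i => cross ξ (z.1 i) := by
    funext p; simp [angularMomentum, formOf_apply, inner_sum, inner_cross_left]
  have e2 : (fun q : Config => ⟪ξ, angularMomentum (q, z.2)⟫_ℝ) =
      formOf fun i => cross (z.2 i) ξ := by
    funext p; simp [angularMomentum, formOf_apply, inner_sum, inner_cross_right ξ]
  refine Prod.ext (funext fun i => ?_) (funext fun i => congrArg Neg.neg ?_)
  · refine partialGradient_eq_of_hasFDerivAt
      (f := fun p : Config => ⟪ξ, angularMomentum (z.1, p)⟫_ℝ) (G := fun i => cross ξ (z.1 i)) ?_ i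
    rw [e1]; exact (formOf _).hasFDerivAt
  · refine partialGradient_eq_of_hasFDerivAt
      (f := fun q : Config => ⟪ξ, angularMomentum (q, z.2)⟫_ℝ) (G := fun i => cross (z.2 i) ξ) ?_ i
    rw [e2]; exact (formOf _).hasFDerivAt

/-! ### Relative equilibria and critical points -/

/-- The equations of uniform rotation with angular velocity `ξ`. -/
def IsRotating (m Q : Fin 3 → ℝ) (ξ : Space) (z : Phase) : Prop :=
  (∀ i, z.2 i = m i • cross ξ (z.1 i)) ∧
    ∀ i, potentialGradient Q z.1 i = m i • (⟪ξ, ξ⟫_ℝ • z.1 i - ⟪ξ, z.1 i⟫_ℝ • ξ)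

theorem isRelativeEquilibrium_iff {m Q : Fin 3 → ℝ} (hm : ∀ i, 0 < m i) {z : Phase}
    (h : CollisionFree z.1) :
    IsRelativeEquilibrium m Q z ↔
      (z.2 ≠ 0 ∨ potentialGradient Q z.1 ≠ 0) ∧ ∃ ξ, IsRotating m Q ξ z := by
  unfold IsRelativeEquilibrium
  simp only [hamiltonianVectorField_hamiltonian m Q h, hamiltonianVectorField_angularMomentum]
  refine and_congr ?_ (exists_congr fun ξ => ?_)
  · rw [← not_and_or, not_iff_not, Prod.ext_iff]
    refine and_congr ?_ ?_
    · simp only [funext_iff, Prod.fst_zero, Pi.zero_apply]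
      refine forall_congr' fun i => ?_
      simp [(hm i).ne']
    · simp [funext_iff]
  · rw [Prod.ext_iff, IsRotating]
    simp only [funext_iff, neg_inj]
    have h1 : (∀ i, (m i)⁻¹ • z.2 i = cross ξ (z.1 i)) ↔ ∀ i, z.2 i = m i • cross ξ (z.1 i) :=
      forall_congr' fun i => inv_smul_eq_iff₀ (hm i).ne'
    rw [h1]
    refine and_congr_right fun h2 => forall_congr' fun i => ?_
    rw [h2 i, cross_smul_left, cross_cross_self]

/-- In uniform rotation `dH = ⟪ξ, dL⟫`, so a tangent vector killed by `dL` is killed by `dH`, and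
`(1, 0, 0, 0)` is not in the range of the derivative. -/
theorem isCriticalPoint_of_isRotating {m Q : Fin 3 → ℝ} (hm : ∀ i, 0 < m i) {z : Phase}
    (h : CollisionFree z.1) (hC : centerOfMass m z.1 = 0) (hP : totalMomentum z = 0) {ξ : Space}
    (hz : IsRotating m Q ξ z) : IsCriticalPoint m Q z := by
  refine ⟨h, hC, hP, fun hs => ?_⟩
  obtain ⟨v, hv⟩ := hs (1, 0, 0, 0)
  rw [fderiv_integralMap_apply m Q h] at hv
  simp only [Prod.mk.injEq] at hv
  obtain ⟨h1, h2, -, -⟩ := hv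
  have h3 := congrArg (fun x => ⟪ξ, x⟫_ℝ) h2
  simp only [inner_sum, inner_zero_right, inner_add_right, inner_cross_left,
    inner_cross_right ξ (v.1 _), Finset.sum_add_distrib] at h3
  have h4 : ∀ i, (m i)⁻¹ • z.2 i = cross ξ (z.1 i) := fun i => by
    rw [hz.1 i, inv_smul_smul₀ (hm i).ne']
  have h5 : ∀ i, potentialGradient Q z.1 i = cross (z.2 i) ξ := fun i => by
    rw [hz.2 i, hz.1 i, cross_smul_left, cross_cross_self]
  simp only [h4, h5] at h1
  linarith

theorem exists_inner_eq (f : Space →ₗ[ℝ] ℝ) : ∃ l : Space, ∀ x, f x = ⟪l, x⟫_ℝ := by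
  refine ⟨(InnerProductSpace.toDual ℝ Space).symm (LinearMap.toContinuousLinearMap f), fun x => ?_⟩
  rw [InnerProductSpace.toDual_symm_apply]
  rfl

/-- Lagrange multipliers for a critical point. -/
theorem exists_multipliers {m Q : Fin 3 → ℝ} {z : Phase} (hz : IsCriticalPoint m Q z) :
    ∃ (h : ℝ) (l a c : Space), ¬ (h = 0 ∧ l = 0 ∧ a = 0 ∧ c = 0) ∧
      (∀ i, (h * (m i)⁻¹) • z.2 i + cross l (z.1 i) + a = 0) ∧
      ∀ i, h • potentialGradient Q z.1 i + cross (z.2 i) l + ((∑ i, m i)⁻¹ * m i) • c = 0 := by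
  obtain ⟨hq, -, -, hs⟩ := hz
  have hlt : LinearMap.range (fderiv ℝ (integralMap m Q) z).toLinearMap < ⊤ :=
    lt_top_iff_ne_top.mpr fun h => hs (LinearMap.range_eq_top.mp h)
  -- A proper subspace lies in the kernel of a non-zero functional; `l`, `a`, `c` below represent
  -- its components, and testing it on `Pi.single i w` yields the equations body by body.
  obtain ⟨f, hf, hfle⟩ := Submodule.exists_le_ker_of_lt_top _ hlt
  have hf0 : ∀ v, f (fderiv ℝ (integralMap m Q) z v) = 0 := fun v =>
    hfle (LinearMap.mem_range_self (fderiv ℝ (integralMap m Q) z).toLinearMap v)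
  obtain ⟨l, hl⟩ := exists_inner_eq (f ∘ₗ LinearMap.inr ℝ ℝ (Space × Space × Space) ∘ₗ
    LinearMap.inl ℝ Space (Space × Space))
  obtain ⟨a, ha⟩ := exists_inner_eq (f ∘ₗ LinearMap.inr ℝ ℝ (Space × Space × Space) ∘ₗ
    LinearMap.inr ℝ Space (Space × Space) ∘ₗ LinearMap.inl ℝ Space Space)
  obtain ⟨c, hc⟩ := exists_inner_eq (f ∘ₗ LinearMap.inr ℝ ℝ (Space × Space × Space) ∘ₗ
    LinearMap.inr ℝ Space (Space × Space) ∘ₗ LinearMap.inr ℝ Space Space)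
  simp only [LinearMap.comp_apply, LinearMap.inr_apply, LinearMap.inl_apply] at hl ha hc
  have key : ∀ x : ℝ × Space × Space × Space, f x =
      x.1 * f (1, 0, 0, 0) + ⟪l, x.2.1⟫_ℝ + ⟪a, x.2.2.1⟫_ℝ + ⟪c, x.2.2.2⟫_ℝ := by
    rintro ⟨x, y, u, w⟩
    rw [← hl, ← ha, ← hc, ← smul_eq_mul, ← map_smul, ← map_add, ← map_add, ← map_add]
    simp
  refine ⟨f (1, 0, 0, 0), l, a, c, ?_, fun i => ?_, fun i => ?_⟩
  · rintro ⟨h1, rfl, rfl, rfl⟩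
    apply hf
    refine LinearMap.ext fun x => ?_
    rw [key x, h1]
    simp only [mul_zero, inner_zero_left, add_zero, LinearMap.zero_apply]
  · refine ext_inner_right ℝ fun w => ?_
    have h1 := hf0 (0, Pi.single i w)
    rw [fderiv_integralMap_apply m Q hq, key] at h1
    have e1 : ∀ g : Config, ∑ j, ⟪g j, (Pi.single i w : Config) j⟫_ℝ = ⟪g i, w⟫_ℝ := fun g => by
      rw [Finset.sum_eq_single i (fun j _ hj => by simp [Pi.single_eq_of_ne hj]) (by simp)]
      simp
    have e2 : ∑ j, cross (z.1 j) ((Pi.single i w : Config) j) = cross (z.1 i) w := by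
      rw [Finset.sum_eq_single i
        (fun j _ hj => by simp [Pi.single_eq_of_ne hj, cross_zero_right]) (by simp)]
      simp
    have e3 : ∑ j, (Pi.single i w : Config) j = w := by simp
    simp only [Pi.zero_apply, inner_zero_right,
      Finset.sum_const_zero, cross_zero_left, add_zero, totalMomentum, centerOfMass, smul_zero,
      e1, e2, e3, inner_cross_left] at h1
    rw [inner_add_left, inner_add_left, inner_zero_left, mul_smul, inner_smul_left, conj_trivial]
    linarith
  · refine ext_inner_right ℝ fun w => ?_
    have h1 := hf0 (Pi.single i w, 0)
    rw [fderiv_integralMap_apply m Q hq, key] at h1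
    have e1 : ∀ g : Config, ∑ j, ⟪g j, (Pi.single i w : Config) j⟫_ℝ = ⟪g i, w⟫_ℝ := fun g => by
      rw [Finset.sum_eq_single i (fun j _ hj => by simp [Pi.single_eq_of_ne hj]) (by simp)]
      simp
    have e2 : ∑ j, cross ((Pi.single i w : Config) j) (z.2 j) = cross w (z.2 i) := by
      rw [Finset.sum_eq_single i
        (fun j _ hj => by simp [Pi.single_eq_of_ne hj, cross_zero_left]) (by simp)]
      simp
    have e3 : ∑ j, m j • (Pi.single i w : Config) j = m i • w := by
      rw [Finset.sum_eq_single i (fun j _ hj => by simp [Pi.single_eq_of_ne hj]) (by simp)]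
      simp
    simp only [Pi.zero_apply, inner_zero_right,
      Finset.sum_const_zero, cross_zero_right, zero_add, totalMomentum, centerOfMass,
      e1, e2, e3, inner_cross_right l, add_zero, inner_smul_right] at h1
    rw [inner_add_left, inner_add_left, inner_zero_left, inner_smul_left, inner_smul_left,
      conj_trivial, conj_trivial]
    linarith

theorem sum_mass_pos {m : Fin 3 → ℝ} (hm : ∀ i, 0 < m i) : 0 < ∑ i, m i :=
  Finset.sum_pos (fun i _ => hm i) ⟨0, Finset.mem_univ 0⟩

theorem centerOfMass_eq_zero_iff {m : Fin 3 → ℝ} (hm : ∀ i, 0 < m i) (q : Config) :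
    centerOfMass m q = 0 ↔ ∑ i, m i • q i = 0 := by
  simp [centerOfMass, (sum_mass_pos hm).ne']

theorem isCollinear_of_forall_smul {q : Config} {v : Space} (h : ∀ i, ∃ r : ℝ, q i = r • v) :
    IsCollinear q := by
  refine (collinear_iff_exists_forall_eq_smul_vadd _).mpr ⟨0, v, ?_⟩
  rintro _ ⟨i, rfl⟩
  simpa using h i

/-- A critical point is collinear or in uniform rotation. -/
theorem IsCriticalPoint.isCollinear_or_isRotating {m Q : Fin 3 → ℝ} (hm : ∀ i, 0 < m i)
    {z : Phase} (hz : IsCriticalPoint m Q z) : IsCollinear z.1 ∨ ∃ ξ, IsRotating m Q ξ z := by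
  obtain ⟨h, l, a, c, h0, h1, h2⟩ := exists_multipliers hz
  obtain ⟨-, hC, hP, -⟩ := hz
  rw [centerOfMass_eq_zero_iff hm] at hC
  have hM := (sum_mass_pos hm).ne'
  -- The mass-weighted sum of the first equations: the other terms vanish because centre of mass and
  -- total momentum do.
  have ha : a = 0 := by
    have h3 : ∑ i, m i • ((h * (m i)⁻¹) • z.2 i + cross l (z.1 i) + a) = 0 := by simp [h1]
    have h4 : ∀ i, m i • ((h * (m i)⁻¹) • z.2 i + cross l (z.1 i) + a) =
        h • z.2 i + cross l (m i • z.1 i) + m i • a := fun i => by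
      rw [smul_add, smul_add, smul_smul, cross_smul_right, mul_left_comm,
        mul_inv_cancel₀ (hm i).ne', mul_one]
    simp only [h4, Finset.sum_add_distrib, ← Finset.smul_sum, ← Finset.sum_smul] at h3
    have h5 : ∑ i, cross l (m i • z.1 i) = cross l (∑ i, m i • z.1 i) :=
      (map_sum (crossL l) _ _).symm
    have h6 : ∑ i, z.2 i = 0 := hP
    rw [h5, hC, h6, cross_zero_right, smul_zero, zero_add, zero_add] at h3
    exact (smul_eq_zero.mp h3).resolve_left hM
  -- The plain sum of the second equations: internal forces and momenta both add up to zero.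
  have hc : c = 0 := by
    have h3 : ∑ i, (h • potentialGradient Q z.1 i + cross (z.2 i) l +
        ((∑ i, m i)⁻¹ * m i) • c) = 0 := by simp [h2]
    rw [Finset.sum_add_distrib, Finset.sum_add_distrib, ← Finset.smul_sum,
      sum_potentialGradient, ← Finset.sum_smul, ← Finset.mul_sum, inv_mul_cancel₀ hM] at h3
    have h5 : ∑ i, cross (z.2 i) l = cross (∑ i, z.2 i) l :=
      (map_sum (crossL.flip l) _ _).symm
    have h6 : ∑ i, z.2 i = 0 := hP
    simpa [h5, h6, cross_zero_left] using h3
  subst ha hc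
  by_cases hh : h = 0
  · subst hh
    have hl : l ≠ 0 := fun hl => h0 ⟨rfl, hl, rfl, rfl⟩
    left
    refine isCollinear_of_forall_smul (v := l) fun i => exists_smul_eq_of_cross_eq_zero hl ?_
    simpa using h1 i
  · right
    have hp : ∀ i, z.2 i = m i • cross (-h⁻¹ • l) (z.1 i) := fun i => by
      have h3 := h1 i
      rw [add_zero] at h3
      rw [cross_smul_left, ← neg_eq_of_add_eq_zero_right h3, smul_smul, smul_neg, smul_smul,
        ← neg_smul]
      have : -(m i * -h⁻¹ * (h * (m i)⁻¹)) = 1 := by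
        have := (hm i).ne'
        field_simp
      rw [this, one_smul]
    refine ⟨-h⁻¹ • l, hp, fun i => ?_⟩
    have h3 := h2 i
    rw [smul_zero, add_zero] at h3
    rw [← cross_cross_self, ← cross_smul_left, ← hp i, cross_smul_right, neg_smul, ← smul_neg,
      neg_eq_of_add_eq_zero_left h3, inv_smul_smul₀ hh]

/-! ### Non-collinear central configurations -/

theorem isCollinear_of_smul_add_smul_eq_zero {q : Config} {i j k : Fin 3}
    (hijk : ∀ n, n = i ∨ n = j ∨ n = k)
    {α β : ℝ} (hα : α ≠ 0) (h : α • (q i - q j) + β • (q i - q k) = 0) : IsCollinear q := by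
  refine (collinear_iff_exists_forall_eq_smul_vadd _).mpr ⟨q i, q i - q k, ?_⟩
  rintro _ ⟨n, rfl⟩
  rcases hijk n with rfl | rfl | rfl
  · exact ⟨0, by simp⟩
  · refine ⟨α⁻¹ * β, ?_⟩
    rw [mul_smul, ← neg_eq_of_add_eq_zero_right h, smul_neg, inv_smul_smul₀ hα]
    simp
  · exact ⟨-1, by simp⟩

/-- Both the force on body `i` and `q i - C` are combinations of `q i - q j` and `q i - q k`. These
are independent off collinearity, so the coefficients must agree. -/
theorem IsCentralWith.charge_mul_charge {m Q : Fin 3 → ℝ} (hm : ∀ i, 0 < m i) {q : Config}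
    {lam : ℝ} (h : IsCentralWith m Q q lam) (hq : ¬ IsCollinear q) {i j : Fin 3} (hij : i ≠ j) :
    Q i * Q j = -lam * (m i * m j * (∑ i, m i)⁻¹ * ‖q i - q j‖ ^ 3) := by
  have hM := (sum_mass_pos hm).ne'
  obtain ⟨k, hijk, hik, hjk⟩ : ∃ k, (∀ n, n = i ∨ n = j ∨ n = k) ∧ i ≠ k ∧ j ≠ k := by
    revert i j; decide
  have hsum : ∀ {E : Type} [AddCommGroup E] (f : Fin 3 → E), ∑ n, f n = f i + f j + f k := by
    intro E _ f
    have : (Finset.univ : Finset (Fin 3)) = {i, j, k} := by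
      ext n; simpa using hijk n
    rw [this, Finset.sum_insert (by simp [hij, hik]), Finset.sum_insert (by simp [hjk]),
      Finset.sum_singleton, add_assoc]
  have h1 := h.2 i
  rw [partialGradient_potential Q h.1] at h1
  have h2 : q i - centerOfMass m q =
      ((∑ i, m i)⁻¹ * m j) • (q i - q j) + ((∑ i, m i)⁻¹ * m k) • (q i - q k) := by
    have h3 : q i = (∑ i, m i)⁻¹ • (∑ i, m i) • q i := by rw [inv_smul_smul₀ hM]
    rw [centerOfMass, hsum fun n => m n • q n]
    nth_rewrite 1 [h3]
    rw [← smul_sub, mul_smul, mul_smul, ← smul_add, hsum m]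
    congr 1
    module
  have hr : ‖q i - q j‖ ≠ 0 := norm_ne_zero_iff.mpr (sub_ne_zero.mpr (h.1 i j hij))
  have h4 : (Q i * Q j / ‖q i - q j‖ ^ 3 + lam * m i * ((∑ i, m i)⁻¹ * m j)) • (q i - q j) +
      (Q i * Q k / ‖q i - q k‖ ^ 3 + lam * m i * ((∑ i, m i)⁻¹ * m k)) • (q i - q k) = 0 := by
    rw [h2, potentialGradient, hsum, sub_self, smul_zero, zero_add] at h1
    rw [neg_eq_iff_add_eq_zero] at h1
    rw [← h1]
    module
  have h5 : Q i * Q j / ‖q i - q j‖ ^ 3 + lam * m i * ((∑ i, m i)⁻¹ * m j) = 0 := by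
    by_contra h6
    exact hq (isCollinear_of_smul_add_smul_eq_zero hijk h6 h4)
  field_simp at h5 ⊢
  linarith

/-- A positive multiplier would make all three products of charges negative, but their product is
the square of `Q 0 * Q 1 * Q 2`. -/
theorem IsCentralWith.nonpos_of_not_isCollinear {m Q : Fin 3 → ℝ} (hm : ∀ i, 0 < m i)
    {q : Config} {lam : ℝ} (h : IsCentralWith m Q q lam) (hq : ¬ IsCollinear q) : lam ≤ 0 := by
  by_contra hlam
  push Not at hlam
  have key : ∀ i j, i ≠ j → Q i * Q j < 0 := fun i j hij => by
    rw [h.charge_mul_charge hm hq hij, neg_mul, neg_lt_zero]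
    have hr : 0 < ‖q i - q j‖ := norm_pos_iff.mpr (sub_ne_zero.mpr (h.1 i j hij))
    have := inv_pos.mpr (sum_mass_pos hm)
    have := hm i
    have := hm j
    positivity
  have h1 := key 0 1 (by decide)
  have h2 := key 0 2 (by decide)
  have h3 := key 1 2 (by decide)
  nlinarith [mul_pos_of_neg_of_neg h1 h2, sq_nonneg (Q 0 * Q 1 * Q 2), sq_nonneg (Q 0)]

theorem IsCentralWith.neg_of_not_isCollinear {m Q : Fin 3 → ℝ} (hm : ∀ i, 0 < m i)
    {q : Config} {lam : ℝ} (h : IsCentralWith m Q q lam) (hq : ¬ IsCollinear q)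
    (hQ : ∃ i j, i ≠ j ∧ Q i ≠ 0 ∧ Q j ≠ 0) : lam < 0 := by
  refine lt_of_le_of_ne (h.nonpos_of_not_isCollinear hm hq) ?_
  rintro rfl
  obtain ⟨i, j, hij, hi, hj⟩ := hQ
  have := h.charge_mul_charge hm hq hij
  simp [hi, hj] at this

/-- The multiplier of a non-collinear rotating central configuration. -/
theorem IsRotating.multiplier_eq {m Q : Fin 3 → ℝ} (hm : ∀ i, 0 < m i) {z : Phase} {ξ : Space}
    (hz : IsRotating m Q ξ z) (hC : centerOfMass m z.1 = 0) {lam : ℝ}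
    (h : IsCentralWith m Q z.1 lam) (hq : ¬ IsCollinear z.1) : lam = ⟪ξ, ξ⟫_ℝ := by
  have h1 : ∀ i, lam • z.1 i = ⟪ξ, ξ⟫_ℝ • z.1 i - ⟪ξ, z.1 i⟫_ℝ • ξ := fun i => by
    have h2 := h.2 i
    rw [partialGradient_potential Q h.1, hz.2 i, hC, sub_zero, mul_comm, mul_smul] at h2
    exact (smul_right_injective _ (hm i).ne' h2).symm
  obtain ⟨i, hi⟩ : ∃ i, z.1 i ≠ 0 := by
    by_contra h2
    push Not at h2
    exact h.1 0 1 (by decide) (by rw [h2, h2])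
  by_cases hξ : ξ = 0
  · subst hξ
    have := h1 i
    simpa [hi] using this
  -- The right side of `h1` is orthogonal to `ξ`. So either `lam = 0`, which puts every body on the
  -- axis of rotation, or every position is orthogonal to `ξ`.
  have h3 : ∀ i, lam * ⟪ξ, z.1 i⟫_ℝ = 0 := fun i => by
    have := congrArg (fun x => ⟪ξ, x⟫_ℝ) (h1 i)
    simp only [inner_smul_right, inner_sub_right] at this
    rw [this]; ring
  have hξ' : ⟪ξ, ξ⟫_ℝ ≠ 0 := inner_self_ne_zero.mpr hξ
  by_cases hlam : lam = 0
  · exfalso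
    refine hq (isCollinear_of_forall_smul (v := ξ) fun i => ⟨(⟪ξ, ξ⟫_ℝ)⁻¹ * ⟪ξ, z.1 i⟫_ℝ, ?_⟩)
    have := h1 i
    rw [hlam, zero_smul] at this
    rw [mul_smul, ← sub_eq_zero.mp this.symm, inv_smul_smul₀ hξ']
  · have h4 := h1 i
    rw [(mul_eq_zero.mp (h3 i)).resolve_left hlam, zero_smul, sub_zero] at h4
    exact smul_left_injective ℝ hi h4

theorem IsRotating.ne_zero {m Q : Fin 3 → ℝ} {z : Phase} {ξ : Space}
    (hz : IsRotating m Q ξ z) (h : z.2 ≠ 0 ∨ potentialGradient Q z.1 ≠ 0) : ξ ≠ 0 := by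
  rintro rfl
  refine h.elim (fun h => h (funext fun i => ?_)) (fun h => h (funext fun i => ?_))
  · simp [hz.1 i, cross_zero_left]
  · simp [hz.2 i]

theorem IsAssociatedToCentral.isCollinear {m Q : Fin 3 → ℝ} (hm : ∀ i, 0 < m i) {z : Phase}
    (hz : IsAssociatedToCentral m Q z) : IsCollinear z.1 := by
  by_contra hq
  obtain ⟨⟨hcf, hC, -, -⟩, hr, lam, hlam⟩ := hz
  obtain ⟨hne, ξ, hξ⟩ := (isRelativeEquilibrium_iff hm hcf).mp hr
  have h1 := hξ.multiplier_eq hm hC hlam hq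
  have h2 := hlam.nonpos_of_not_isCollinear hm hq
  rw [h1] at h2
  exact hξ.ne_zero hne (real_inner_self_nonpos.mp h2)

theorem not_isCriticalPoint_of_isCentral {m Q : Fin 3 → ℝ} (hm : ∀ i, 0 < m i)
    (hQ : ∃ i j, i ≠ j ∧ Q i ≠ 0 ∧ Q j ≠ 0) {q : Config} (hq : ¬ IsCollinear q)
    (h : IsCentral m Q q) (p : Config) : ¬ IsCriticalPoint m Q (q, p) := by
  intro hz
  obtain ⟨lam, hlam⟩ := h
  have h1 := hlam.neg_of_not_isCollinear hm hq hQ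
  obtain ⟨ξ, hξ⟩ := (hz.isCollinear_or_isRotating hm).resolve_left hq
  rw [hξ.multiplier_eq hm hz.2.1 hlam hq] at h1
  exact h1.not_ge real_inner_self_nonneg

/-! ### Rotations -/

/-- The standard unit vectors. -/
def unitVec (k : Fin 3) : Space := EuclideanSpace.single k 1

theorem unitVec_apply (k i : Fin 3) : unitVec k i = if i = k then 1 else 0 := by
  simp [unitVec]

theorem norm_unitVec (k : Fin 3) : ‖unitVec k‖ = 1 := by simp [unitVec]

theorem inner_unitVec_of_ne {i j : Fin 3} (h : i ≠ j) : ⟪unitVec i, unitVec j⟫_ℝ = 0 := by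
  simp [unitVec, EuclideanSpace.inner_single_left, h]

theorem cross_unitVec_two_zero : cross (unitVec 2) (unitVec 0) = unitVec 1 := by
  apply Space.ext_coord <;>
  simp [cross_zero_coord, cross_one_coord, cross_two_coord, unitVec_apply]

theorem unitVec_ne_zero (k : Fin 3) : unitVec k ≠ 0 := by
  rw [← norm_ne_zero_iff, norm_unitVec]; exact one_ne_zero

instance fact_finrank_space : Fact (Module.finrank ℝ Space = 2 + 1) := ⟨by simp⟩

/-- The rotation by `π` about the third axis. -/
theorem exists_halfTurn : ∃ R : Space ≃ₗᵢ[ℝ] Space,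
    LinearMap.det (R.toLinearEquiv : Space →ₗ[ℝ] Space) = 1 ∧
      R (unitVec 0) = -unitVec 0 ∧ R (unitVec 1) = -unitVec 1 := by
  refine ⟨(Submodule.span ℝ {unitVec 2}).reflection, ?_, ?_, ?_⟩
  · have h := (Submodule.span ℝ {unitVec 2}).det_reflection
    rw [Submodule.finrank_orthogonal_span_singleton (n := 2) (unitVec_ne_zero 2)] at h
    refine Eq.trans ?_ (h.trans (by norm_num))
    rfl
  · exact Submodule.reflection_mem_subspace_orthogonalComplement_eq_neg
      (Submodule.mem_orthogonal_singleton_iff_inner_right.mpr (inner_unitVec_of_ne (by decide)))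
  · exact Submodule.reflection_mem_subspace_orthogonalComplement_eq_neg
      (Submodule.mem_orthogonal_singleton_iff_inner_right.mpr (inner_unitVec_of_ne (by decide)))

/-- Used in `exists_rotation` to correct the orientation of an isometry without moving the first two
axes. -/
theorem exists_mirror : ∃ R : Space ≃ₗᵢ[ℝ] Space,
    LinearMap.det (R.toLinearEquiv : Space →ₗ[ℝ] Space) = -1 ∧
      R (unitVec 0) = unitVec 0 ∧ R (unitVec 1) = unitVec 1 := by
  refine ⟨(Submodule.span ℝ {unitVec 2})ᗮ.reflection, ?_, ?_, ?_⟩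
  · have h := (Submodule.span ℝ {unitVec 2})ᗮ.det_reflection
    rw [Submodule.orthogonal_orthogonal, finrank_span_singleton (unitVec_ne_zero 2)] at h
    refine Eq.trans ?_ (h.trans (by norm_num))
    rfl
  · exact Submodule.reflection_mem_subspace_eq_self
      (Submodule.mem_orthogonal_singleton_iff_inner_right.mpr (inner_unitVec_of_ne (by decide)))
  · exact Submodule.reflection_mem_subspace_eq_self
      (Submodule.mem_orthogonal_singleton_iff_inner_right.mpr (inner_unitVec_of_ne (by decide)))

theorem det_eq_one_or_neg_one (R : Space ≃ₗᵢ[ℝ] Space) :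
    LinearMap.det (R.toLinearEquiv : Space →ₗ[ℝ] Space) = 1 ∨
      LinearMap.det (R.toLinearEquiv : Space →ₗ[ℝ] Space) = -1 := by
  have h := R.toLinearIsometry.normDet_eq_one
  rw [LinearMap.normDet_eq_norm_det, Real.norm_eq_abs] at h
  exact eq_or_eq_neg_of_abs_eq h

theorem exists_rotation {u w : Space} (hu : ‖u‖ = 1) (hw : ‖w‖ = 1) (huw : ⟪u, w⟫_ℝ = 0) :
    ∃ R : Space ≃ₗᵢ[ℝ] Space, LinearMap.det (R.toLinearEquiv : Space →ₗ[ℝ] Space) = 1 ∧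
      R u = unitVec 0 ∧ R w = unitVec 1 := by
  have ho : Orthonormal ℝ (({0, 1} : Set (Fin 3)).domRestrict ![u, w, 0]) := by
    constructor
    · rintro ⟨i, rfl | rfl⟩
      · simpa using hu
      · simpa using hw
    · rintro ⟨i, rfl | rfl⟩ ⟨j, rfl | rfl⟩ hij
      · exact absurd rfl hij
      · simpa using huw
      · simpa [real_inner_comm] using huw
      · exact absurd rfl hij
  obtain ⟨b, hb⟩ := ho.exists_orthonormalBasis_extension_of_card_eq (by simp)
  have h0 : b.repr u = unitVec 0 := by
    have : b 0 = u := by simpa using hb 0 (by simp)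
    rw [← this, b.repr_self]; rfl
  have h1 : b.repr w = unitVec 1 := by
    have : b 1 = w := by simpa using hb 1 (by simp)
    rw [← this, b.repr_self]; rfl
  rcases det_eq_one_or_neg_one b.repr with hd | hd
  · exact ⟨b.repr, hd, h0, h1⟩
  · obtain ⟨S, hS, hS0, hS1⟩ := exists_mirror
    refine ⟨b.repr.trans S, ?_, ?_, ?_⟩
    · have h : ((b.repr.trans S).toLinearEquiv : Space →ₗ[ℝ] Space) =
        (S.toLinearEquiv : Space →ₗ[ℝ] Space) ∘ₗ (b.repr.toLinearEquiv : Space →ₗ[ℝ] Space) := rfl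
      rw [h, LinearMap.det_comp, hS, hd]; norm_num
    · rw [LinearIsometryEquiv.trans_apply, h0, hS0]
    · rw [LinearIsometryEquiv.trans_apply, h1, hS1]

/-! ### Rotating configurations on a line -/

/-- Positions `x` on a line that form a rotating central configuration with multiplier `lam`. -/
def IsEuler (m Q x : Fin 3 → ℝ) (lam : ℝ) : Prop :=
  Function.Injective x ∧ 0 < lam ∧
    ∀ i, -∑ j, Q i * Q j / |x i - x j| ^ 3 * (x i - x j) = lam * m i * x i

/-- The phase point with positions `x` on the first axis, rotating about the third axis. -/
def linePoint (m x : Fin 3 → ℝ) (lam : ℝ) : Phase :=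
  (fun i => x i • unitVec 0, fun i => (√lam * m i * x i) • unitVec 1)

theorem norm_smul_unitVec_sub (a b : ℝ) (k : Fin 3) :
    ‖a • unitVec k - b • unitVec k‖ = |a - b| := by
  rw [← sub_smul, norm_smul, norm_unitVec, mul_one, Real.norm_eq_abs]

theorem potentialGradient_smul (Q x : Fin 3 → ℝ) {u : Space} (hu : ‖u‖ = 1) (i : Fin 3) :
    potentialGradient Q (fun i => x i • u) i =
      (-∑ j, Q i * Q j / |x i - x j| ^ 3 * (x i - x j)) • u := by
  simp only [potentialGradient, neg_smul, Finset.sum_smul]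
  congr 1
  refine Finset.sum_congr rfl fun j _ => ?_
  rw [← sub_smul, norm_smul, hu, mul_one, Real.norm_eq_abs, smul_smul]

/-- Internal forces cancel and `lam` is not zero, so the equations centre the configuration by
themselves. -/
theorem IsEuler.sum_mass_mul {m Q x : Fin 3 → ℝ} {lam : ℝ} (h : IsEuler m Q x lam) :
    ∑ i, m i * x i = 0 := by
  have h1 := sum_potentialGradient Q (fun i => x i • unitVec 0)
  simp only [potentialGradient_smul Q x (norm_unitVec 0), h.2.2] at h1
  rw [← Finset.sum_smul] at h1
  have h2 := (smul_eq_zero.mp h1).resolve_right (unitVec_ne_zero 0)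
  simp only [mul_assoc] at h2
  rw [← Finset.mul_sum] at h2
  exact (mul_eq_zero.mp h2).resolve_left h.2.1.ne'

theorem IsEuler.exists_ne_zero {m Q x : Fin 3 → ℝ} {lam : ℝ} (h : IsEuler m Q x lam) :
    ∃ i, x i ≠ 0 := by
  by_contra h1
  push Not at h1
  exact absurd (h.1 (a₁ := 0) (a₂ := 1) (by rw [h1, h1])) (by decide)

theorem IsEuler.multiplier_unique {m Q x : Fin 3 → ℝ} (hm : ∀ i, 0 < m i) {lam lam' : ℝ}
    (h : IsEuler m Q x lam) (h' : IsEuler m Q x lam') : lam = lam' := by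
  obtain ⟨i, hi⟩ := h.exists_ne_zero
  have h1 := (h.2.2 i).symm.trans (h'.2.2 i)
  exact mul_right_cancel₀ (hm i).ne' (mul_right_cancel₀ hi h1)

theorem IsEuler.isAssociatedToCentral {m Q x : Fin 3 → ℝ} (hm : ∀ i, 0 < m i) {lam : ℝ}
    (h : IsEuler m Q x lam) :
    IsAssociatedToCentral m Q (linePoint m x lam) ∧ IsCollinear (linePoint m x lam).1 := by
  have hcf : CollisionFree (linePoint m x lam).1 := fun i j hij h1 =>
    hij (h.1 (smul_left_injective ℝ (unitVec_ne_zero 0) h1))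
  have hC : centerOfMass m (linePoint m x lam).1 = 0 := by
    rw [centerOfMass_eq_zero_iff hm]
    simp only [linePoint, smul_smul]
    rw [← Finset.sum_smul, h.sum_mass_mul, zero_smul]
  have hP : totalMomentum (linePoint m x lam) = 0 := by
    simp only [linePoint, totalMomentum, mul_assoc]
    rw [← Finset.sum_smul, ← Finset.mul_sum, h.sum_mass_mul, mul_zero, zero_smul]
  have hG : ∀ i, potentialGradient Q (linePoint m x lam).1 i = (lam * m i * x i) • unitVec 0 :=
    fun i => by rw [← h.2.2 i]; exact potentialGradient_smul Q x (norm_unitVec 0) i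
  have hR : IsRotating m Q (√lam • unitVec 2) (linePoint m x lam) := by
    refine ⟨fun i => ?_, fun i => ?_⟩
    · simp only [linePoint]
      rw [cross_smul_left, cross_smul_right, cross_unitVec_two_zero, smul_smul, smul_smul]
      congr 1; ring
    · rw [hG]
      simp only [linePoint]
      rw [inner_smul_left, inner_smul_right, inner_smul_left, inner_smul_right,
        inner_unitVec_of_ne (show (2 : Fin 3) ≠ 0 by decide), real_inner_self_eq_norm_sq,
        norm_unitVec, conj_trivial]
      simp only [mul_zero, zero_smul, sub_zero]
      rw [smul_smul, smul_smul]
      congr 1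
      rw [one_pow, mul_one, Real.mul_self_sqrt h.2.1.le]; ring
  refine ⟨⟨isCriticalPoint_of_isRotating hm hcf hC hP hR, ?_, lam, hcf, fun i => ?_⟩,
    isCollinear_of_forall_smul fun i => ⟨x i, rfl⟩⟩
  · rw [isRelativeEquilibrium_iff hm hcf]
    refine ⟨Or.inl fun h0 => ?_, _, hR⟩
    obtain ⟨i, hi⟩ := h.exists_ne_zero
    have h1 := congrFun h0 i
    simp [linePoint, hi, unitVec_ne_zero, (hm i).ne', (Real.sqrt_pos.mpr h.2.1).ne'] at h1
  · rw [partialGradient_potential Q hcf, hG, hC, sub_zero, mul_smul]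
    rfl

/-- Every collinear associated critical point is similar to a rotating configuration on the
first axis. -/
theorem IsAssociatedToCentral.exists_isEuler {m Q : Fin 3 → ℝ} (hm : ∀ i, 0 < m i) {z : Phase}
    (hz : IsAssociatedToCentral m Q z) (hcol : IsCollinear z.1) :
    ∃ x lam, IsEuler m Q x lam ∧ Similar z (linePoint m x lam) := by
  obtain ⟨⟨hcf, hC, -, -⟩, hr, -⟩ := hz
  obtain ⟨hne, ξ, hξ⟩ := (isRelativeEquilibrium_iff hm hcf).mp hr
  have hξ0 := hξ.ne_zero hne
  rw [centerOfMass_eq_zero_iff hm] at hC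
  have hM := (sum_mass_pos hm).ne'
  -- the direction of the line
  obtain ⟨u, x, hu, hx⟩ : ∃ (u : Space) (x : Fin 3 → ℝ), ‖u‖ = 1 ∧ z.1 = fun i => x i • u := by
    obtain ⟨p, v, hv⟩ := (collinear_iff_exists_forall_eq_smul_vadd _).mp hcol
    choose r hr' using fun i => hv (z.1 i) ⟨i, rfl⟩
    have h1 : ∀ i, z.1 i = r i • v + p := hr'
    have hp : p = -((∑ i, m i)⁻¹ * ∑ i, m i * r i) • v := by
      simp only [h1, smul_add, Finset.sum_add_distrib, smul_smul, ← Finset.sum_smul] at hC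
      rw [neg_smul, mul_smul, ← neg_eq_of_add_eq_zero_left hC, smul_neg, neg_neg,
        inv_smul_smul₀ hM]
    have hv0 : v ≠ 0 := by
      rintro rfl
      exact hcf 0 1 (by decide) (by rw [h1, h1]; simp)
    have hv1 : ‖v‖ ≠ 0 := norm_ne_zero_iff.mpr hv0
    refine ⟨‖v‖⁻¹ • v, fun i => (r i - (∑ i, m i)⁻¹ * ∑ i, m i * r i) * ‖v‖, ?_, ?_⟩
    · rw [norm_smul, norm_inv, norm_norm, inv_mul_cancel₀ hv1]
    · funext i
      rw [smul_smul, mul_assoc, mul_inv_cancel₀ hv1, mul_one, h1 i]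
      nth_rewrite 1 [hp]
      module
  have hu0 : u ≠ 0 := norm_ne_zero_iff.mp (by rw [hu]; exact one_ne_zero)
  have hinj : Function.Injective x := fun i j hij => by
    by_contra h
    exact hcf i j h (by simp only [hx, hij])
  obtain ⟨k, hk⟩ : ∃ k, x k ≠ 0 := by
    by_contra h1
    push Not at h1
    exact absurd (hinj (a₁ := 0) (a₂ := 1) (by rw [h1, h1])) (by decide)
  have hG : ∀ i, (-∑ j, Q i * Q j / |x i - x j| ^ 3 * (x i - x j)) • u =
      (m i * x i) • (⟪ξ, ξ⟫_ℝ • u - ⟪ξ, u⟫_ℝ • ξ) := fun i => by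
    have h1 := hξ.2 i
    rw [hx, potentialGradient_smul Q x hu] at h1
    rw [h1]
    simp only [inner_smul_right]
    module
  -- the angular velocity is orthogonal to the line
  have horth : ⟪ξ, u⟫_ℝ = 0 := by
    by_contra h0
    -- The force on body `k` is along `u`, so `hG k` can be solved for `ξ` as a multiple of `u`.
    -- Rotation about the line itself leaves the bodies fixed, making `z` an equilibrium, against
    -- `hne`.
    have h1 : ∃ c : ℝ, ξ = c • u := by
      have h2 := hG k
      have h3 : m k * x k ≠ 0 := mul_ne_zero (hm k).ne' hk
      rw [eq_comm, ← eq_inv_smul_iff₀ h3, sub_eq_iff_eq_add, ← sub_eq_iff_eq_add',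
        eq_comm, ← eq_inv_smul_iff₀ h0] at h2
      refine ⟨(⟪ξ, u⟫_ℝ)⁻¹ * (⟪ξ, ξ⟫_ℝ - (m k * x k)⁻¹ *
        (-∑ j, Q k * Q j / |x k - x j| ^ 3 * (x k - x j))), ?_⟩
      rw [mul_smul, sub_smul, mul_smul]
      exact h2
    obtain ⟨c, rfl⟩ := h1
    refine hne.elim (fun h => h (funext fun i => ?_)) (fun h => h (funext fun i => ?_))
    · rw [hξ.1 i, hx]
      have : cross u u = 0 := by
        apply Space.ext_coord <;>
        simp only [cross_zero_coord, cross_one_coord, cross_two_coord, PiLp.zero_apply] <;> ring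
      simp [cross_smul_left, cross_smul_right, this]
    · rw [hξ.2 i, hx]
      simp only [inner_smul_left, inner_smul_right, real_inner_self_eq_norm_sq, hu, conj_trivial,
        Pi.zero_apply]
      module
  have hξξ : 0 < ⟪ξ, ξ⟫_ℝ := real_inner_self_pos.mpr hξ0
  have hn : ‖ξ‖ ≠ 0 := norm_ne_zero_iff.mpr hξ0
  have hE : IsEuler m Q x ⟪ξ, ξ⟫_ℝ := by
    refine ⟨hinj, hξξ, fun i => ?_⟩
    have h1 := hG i
    rw [horth, zero_smul, sub_zero, smul_smul] at h1
    rw [smul_left_injective ℝ hu0 h1]; ring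
  refine ⟨x, ⟪ξ, ξ⟫_ℝ, hE, ?_⟩
  have hw : ‖cross ξ u‖ = ‖ξ‖ := by
    have h1 : ‖cross ξ u‖ ^ 2 = ‖ξ‖ ^ 2 := by
      have h2 : ⟪cross ξ u, cross ξ u⟫_ℝ = ⟪ξ, ξ⟫_ℝ * ⟪u, u⟫_ℝ - ⟪ξ, u⟫_ℝ ^ 2 := by
        simp only [inner_eq_coord, cross_zero_coord, cross_one_coord, cross_two_coord]; ring
      rw [horth, real_inner_self_eq_norm_sq, real_inner_self_eq_norm_sq,
        real_inner_self_eq_norm_sq, hu] at h2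
      simpa using h2
    exact (sq_eq_sq₀ (norm_nonneg _) (norm_nonneg _)).mp h1
  -- The line goes to the first axis and the common direction of the velocities, `ξ × u`, to the
  -- second.
  obtain ⟨R, hR, hRu, hRw⟩ := exists_rotation (u := u) (w := ‖ξ‖⁻¹ • cross ξ u) hu
    (by rw [norm_smul, norm_inv, norm_norm, hw, inv_mul_cancel₀ hn])
    (by
      rw [inner_smul_right]
      have : ⟪u, cross ξ u⟫_ℝ = 0 := by
        simp only [inner_eq_coord, cross_zero_coord, cross_one_coord, cross_two_coord]; ring
      rw [this, mul_zero])
  refine ⟨R, 1, hR, one_pos, fun i => ?_, fun i => ?_⟩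
  · rw [hx, map_smul, hRu, one_pow, one_smul]; rfl
  · have h2 : z.2 i = (‖ξ‖ * m i * x i) • ‖ξ‖⁻¹ • cross ξ u := by
      rw [hξ.1 i, hx, cross_smul_right, smul_smul, smul_smul]
      congr 1; field_simp
    rw [h2, map_smul, hRw, inv_one, one_smul]
    simp only [linePoint, real_inner_self_eq_norm_sq, Real.sqrt_sq (norm_nonneg _)]

/-- The forces are homogeneous of degree `-2` and the right side has degree `1`, which accounts for
the exponent `3`. -/
theorem IsEuler.smul {m Q x : Fin 3 → ℝ} {lam : ℝ} (h : IsEuler m Q x lam) {s : ℝ} (hs : s ≠ 0) :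
    IsEuler m Q (s • x) (lam / |s| ^ 3) := by
  have hs' : 0 < |s| := abs_pos.mpr hs
  refine ⟨fun i j hij => h.1 (mul_left_cancel₀ hs hij), div_pos h.2.1 (pow_pos hs' 3),
    fun i => ?_⟩
  have h1 : ∀ j, Q i * Q j / |(s • x) i - (s • x) j| ^ 3 * ((s • x) i - (s • x) j) =
      (s / |s| ^ 3) * (Q i * Q j / |x i - x j| ^ 3 * (x i - x j)) := fun j => by
    simp only [Pi.smul_apply, smul_eq_mul]
    rw [← mul_sub, abs_mul, mul_pow]
    field_simp
  simp only [h1]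
  rw [← Finset.mul_sum, ← mul_neg, h.2.2 i, Pi.smul_apply, smul_eq_mul]
  ring

/-- The dilation factor is `√|s|`; a negative `s` is absorbed by the half-turn about the axis of
rotation. -/
theorem similar_linePoint_smul (m x : Fin 3 → ℝ) {lam : ℝ} {s : ℝ}
    (hs : s ≠ 0) : Similar (linePoint m x lam) (linePoint m (s • x) (lam / |s| ^ 3)) := by
  have hs' : 0 < |s| := abs_pos.mpr hs
  have hsq : √|s| ^ 2 = |s| := Real.sq_sqrt hs'.le
  have hsp : 0 < √|s| := Real.sqrt_pos.mpr hs'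
  have h3 : √(lam / |s| ^ 3) = √lam / (|s| * √|s|) := by
    rw [Real.sqrt_div' _ (pow_nonneg hs'.le 3)]
    congr 1
    rw [show |s| ^ 3 = |s| ^ 2 * |s| by ring, Real.sqrt_mul (sq_nonneg _), Real.sqrt_sq hs'.le]
  have h4 : ∀ i, √lam / (|s| * √|s|) * m i * (|s| * x i) = (√|s|)⁻¹ * (√lam * m i * x i) :=
    fun i => by field_simp
  rcases hs.lt_or_gt with h | h
  · obtain ⟨R, hR, h0, h1⟩ := exists_halfTurn
    have hse : s = -|s| := by rw [abs_of_neg h, neg_neg]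
    refine ⟨R, √|s|, hR, hsp, fun i => ?_, fun i => ?_⟩
    · simp only [linePoint, map_smul, h0, hsq, smul_smul, Pi.smul_apply, smul_eq_mul, smul_neg]
      rw [← neg_smul, ← neg_mul, ← hse]
    · simp only [linePoint, map_smul, h1, h3, smul_smul, Pi.smul_apply, smul_eq_mul, smul_neg]
      rw [← neg_smul, ← h4]
      congr 1
      nth_rewrite 3 [hse]
      ring
  · have hse : s = |s| := (abs_of_pos h).symm
    refine ⟨LinearIsometryEquiv.refl ℝ Space, √|s|, LinearMap.det_id, hsp, fun i => ?_,
      fun i => ?_⟩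
    · simp only [linePoint, LinearIsometryEquiv.coe_refl, id_eq, hsq, smul_smul,
        Pi.smul_apply, smul_eq_mul]
      rw [← hse]
    · simp only [linePoint, LinearIsometryEquiv.coe_refl, id_eq, h3, smul_smul, Pi.smul_apply,
        smul_eq_mul]
      rw [← h4]
      congr 1
      nth_rewrite 3 [hse]
      ring

/-! ### Shapes of collinear configurations -/

theorem sum_cyclic {E : Type*} [AddCommMonoid E] (f : Fin 3 → E) (k : Fin 3) :
    ∑ i, f i = f k + f (k + 1) + f (k + 2) := by
  fin_cases k <;> simp [Fin.sum_univ_three] <;> abel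

theorem forall_cyclic {p : Fin 3 → Prop} (k : Fin 3) :
    (∀ i, p i) ↔ p k ∧ p (k + 1) ∧ p (k + 2) := by
  rw [Fin.forall_fin_succ, Fin.forall_fin_two]
  fin_cases k <;> simp <;> tauto

theorem add_one_ne (k : Fin 3) : k + 1 ≠ k := by revert k; decide

theorem add_two_ne (k : Fin 3) : k + 2 ≠ k := by revert k; decide

theorem add_one_add_one (k : Fin 3) : k + 1 + 1 = k + 2 := by revert k; decide

theorem add_one_add_two (k : Fin 3) : k + 1 + 2 = k := by revert k; decide

theorem add_two_add_one (k : Fin 3) : k + 2 + 1 = k := by revert k; decide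

theorem add_two_add_two (k : Fin 3) : k + 2 + 2 = k + 1 := by revert k; decide

theorem eq_or_eq_add (k l : Fin 3) : l = k ∨ l = k + 1 ∨ l = k + 2 := by revert k l; decide

theorem add_two_ne_add_one (k : Fin 3) : k + 2 ≠ k + 1 := by revert k; decide

/-- The centred configuration with body `k` between `k + 1` and `k + 2`, at distances `1` and
`t`. -/
def normalized (m : Fin 3 → ℝ) (k : Fin 3) (t : ℝ) : Fin 3 → ℝ := fun j =>
  (m (k + 1) - t * m (k + 2)) / ∑ i, m i + if j = k + 1 then -1 else if j = k + 2 then t else 0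

theorem normalized_self (m : Fin 3 → ℝ) (k : Fin 3) (t : ℝ) :
    normalized m k t k = (m (k + 1) - t * m (k + 2)) / ∑ i, m i := by
  simp [normalized, (add_one_ne k).symm, (add_two_ne k).symm]

theorem normalized_add_one (m : Fin 3 → ℝ) (k : Fin 3) (t : ℝ) :
    normalized m k t (k + 1) = (m (k + 1) - t * m (k + 2)) / ∑ i, m i - 1 := by
  simp only [normalized, if_true, ← sub_eq_add_neg]

theorem normalized_add_two (m : Fin 3 → ℝ) (k : Fin 3) (t : ℝ) :
    normalized m k t (k + 2) = (m (k + 1) - t * m (k + 2)) / ∑ i, m i + t := by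
  simp only [normalized, if_neg (add_two_ne_add_one k), if_true]

/-- The condition on the ratio `t` of distances in a collinear configuration of bodies with masses
`m₁`, `m₂`, `m₃` (in this order on the line) attracting each other with strengths `g₁₂`, `g₁₃`,
`g₂₃` to be a central configuration with positive multiplier. -/
def IsEulerRatio (m₁ m₂ m₃ g₁₂ g₁₃ g₂₃ t : ℝ) : Prop :=
  0 < t ∧ 0 < (1 + t) ^ 2 * g₁₂ + g₁₃ ∧
    m₃ * ((1 + t) * m₁ + t * m₂) * (t ^ 2 * ((1 + t) ^ 2 * g₁₂ + g₁₃)) =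
      m₁ * (m₂ + (1 + t) * m₃) * ((1 + t) ^ 2 * g₂₃ + t ^ 2 * g₁₃)

/-- The two equations are the force balances of the outer bodies. The first determines `lam`, whose
positivity is the sign condition; eliminating it leaves the quintic. -/
theorem isEulerRatio_iff_exists {m₁ m₂ m₃ : ℝ} (h₁ : 0 < m₁) (h₂ : 0 < m₂) (h₃ : 0 < m₃)
    (g₁₂ g₁₃ g₂₃ : ℝ) {t : ℝ} (ht : 0 < t) :
    IsEulerRatio m₁ m₂ m₃ g₁₂ g₁₃ g₂₃ t ↔ ∃ lam : ℝ, 0 < lam ∧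
      g₁₂ + g₁₃ / (1 + t) ^ 2 = lam * m₁ * (m₂ + (1 + t) * m₃) / (m₂ + m₁ + m₃) ∧
      g₂₃ / t ^ 2 + g₁₃ / (1 + t) ^ 2 =
        lam * m₃ * ((1 + t) * m₁ + t * m₂) / (m₂ + m₁ + m₃) := by
  have hM : 0 < m₂ + m₁ + m₃ := by positivity
  have ht1 : 0 < 1 + t := by positivity
  constructor
  · rintro ⟨-, h, e⟩
    refine ⟨((1 + t) ^ 2 * g₁₂ + g₁₃) * (m₂ + m₁ + m₃) /
      ((1 + t) ^ 2 * (m₁ * (m₂ + (1 + t) * m₃))), by positivity, ?_, ?_⟩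
    · field_simp
    · field_simp
      linear_combination -e
  · rintro ⟨lam, hl, e1, e2⟩
    refine ⟨ht, ?_, ?_⟩
    · have : (1 + t) ^ 2 * g₁₂ + g₁₃ =
          (1 + t) ^ 2 * (lam * m₁ * (m₂ + (1 + t) * m₃) / (m₂ + m₁ + m₃)) := by
        rw [← e1]; field_simp
      rw [this]; positivity
    · have e3 : (1 + t) ^ 2 * g₁₂ + g₁₃ =
          (1 + t) ^ 2 * (lam * m₁ * (m₂ + (1 + t) * m₃) / (m₂ + m₁ + m₃)) := by
        rw [← e1]; field_simp
      have e4 : (1 + t) ^ 2 * g₂₃ + t ^ 2 * g₁₃ = t ^ 2 * (1 + t) ^ 2 *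
          (lam * m₃ * ((1 + t) * m₁ + t * m₂) / (m₂ + m₁ + m₃)) := by
        rw [← e2]; field_simp
      rw [e3, e4]; field_simp

theorem injective_normalized (m : Fin 3 → ℝ) (k : Fin 3) {t : ℝ} (ht : 0 < t) :
    Function.Injective (normalized m k t) := by
  unfold Function.Injective
  rw [forall_cyclic k]
  refine ⟨?_, ?_, ?_⟩ <;> rw [forall_cyclic k] <;>
    simp only [normalized_self, normalized_add_one, normalized_add_two] <;>
    refine ⟨?_, ?_, ?_⟩ <;> intro h <;> first | trivial | (exfalso; linarith)

/-- The equations of the outer bodies suffice: that of the middle one follows since both the forces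
and the `m i * x i` sum to zero. -/
theorem exists_isEuler_normalized_iff {m : Fin 3 → ℝ} (hm : ∀ i, 0 < m i) (Q : Fin 3 → ℝ)
    (k : Fin 3) {t : ℝ} (ht : 0 < t) :
    (∃ lam, IsEuler m Q (normalized m k t) lam) ↔
      IsEulerRatio (m (k + 1)) (m k) (m (k + 2)) (-(Q (k + 1) * Q k))
        (-(Q (k + 1) * Q (k + 2))) (-(Q k * Q (k + 2))) t := by
  rw [isEulerRatio_iff_exists (hm _) (hm _) (hm _) _ _ _ ht]
  have hM : 0 < m k + m (k + 1) + m (k + 2) := by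
    have := hm k; have := hm (k + 1); have := hm (k + 2); positivity
  have ht1 : 0 < 1 + t := by positivity
  refine exists_congr fun lam => ?_
  simp only [IsEuler, injective_normalized m k ht, true_and]
  refine and_congr_right fun _ => ?_
  rw [forall_cyclic k]
  simp only [sum_cyclic _ k, normalized_self, normalized_add_one, normalized_add_two]
  set x := (m (k + 1) - t * m (k + 2)) / (m k + m (k + 1) + m (k + 2)) with hx
  have hxM : x * (m k + m (k + 1) + m (k + 2)) = m (k + 1) - t * m (k + 2) := by
    rw [hx]; field_simp
  have a1 : |x - (x - 1)| = 1 := by rw [sub_sub_cancel, abs_one]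
  have a2 : |x - (x + t)| = t := by rw [sub_add_cancel_left, abs_neg, abs_of_pos ht]
  have a3 : |x - 1 - (x + t)| = 1 + t := by
    rw [show x - 1 - (x + t) = -(1 + t) by ring, abs_neg, abs_of_pos ht1]
  rw [a1, a2, abs_sub_comm (x - 1) x, a1, a3, abs_sub_comm (x + t) x, a2,
    abs_sub_comm (x + t) (x - 1), a3]
  have b1 : (x - 1) * (m k + m (k + 1) + m (k + 2)) = -(m k + (1 + t) * m (k + 2)) := by
    linear_combination hxM
  have b3 : (x + t) * (m k + m (k + 1) + m (k + 2)) = (1 + t) * m (k + 1) + t * m k := by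
    linear_combination hxM
  have c1 : lam * m (k + 1) * (m k + (1 + t) * m (k + 2)) / (m k + m (k + 1) + m (k + 2)) =
      -(lam * m (k + 1) * (x - 1)) := by
    rw [div_eq_iff hM.ne']
    linear_combination lam * m (k + 1) * b1
  have c3 : lam * m (k + 2) * ((1 + t) * m (k + 1) + t * m k) / (m k + m (k + 1) + m (k + 2)) =
      lam * m (k + 2) * (x + t) := by
    rw [div_eq_iff hM.ne']
    linear_combination -lam * m (k + 2) * b3
  rw [c1, c3]
  have d1 : Q k * Q (k + 1) / 1 ^ 3 * (x - (x - 1)) = Q (k + 1) * Q k := by ring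
  have d1' : Q (k + 1) * Q k / 1 ^ 3 * (x - 1 - x) = -(Q (k + 1) * Q k) := by ring
  have d2 : Q k * Q (k + 2) / t ^ 3 * (x - (x + t)) = -(Q k * Q (k + 2) / t ^ 2) := by
    rw [sub_add_cancel_left]; field_simp
  have d2' : Q (k + 2) * Q k / t ^ 3 * (x + t - x) = Q k * Q (k + 2) / t ^ 2 := by
    rw [add_sub_cancel_left]; field_simp
  have d3 : Q (k + 1) * Q (k + 2) / (1 + t) ^ 3 * (x - 1 - (x + t)) =
      -(Q (k + 1) * Q (k + 2) / (1 + t) ^ 2) := by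
    rw [show x - 1 - (x + t) = -(1 + t) by ring]; field_simp
  have d3' : Q (k + 2) * Q (k + 1) / (1 + t) ^ 3 * (x + t - (x - 1)) =
      Q (k + 1) * Q (k + 2) / (1 + t) ^ 2 := by
    rw [show x + t - (x - 1) = 1 + t by ring]; field_simp
  rw [d1, d1', d2, d2', d3, d3']
  simp only [sub_self, mul_zero, zero_add, add_zero]
  have hsum : m k * x + m (k + 1) * (x - 1) + m (k + 2) * (x + t) = 0 := by
    linear_combination hxM
  rw [neg_div, neg_div]
  constructor
  · rintro ⟨-, e1, e2⟩
    constructor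
    · linear_combination -e1
    · linear_combination e2
  · rintro ⟨e1, e2⟩
    refine ⟨?_, ?_, ?_⟩
    · linear_combination e1 - e2 - lam * hsum
    · linear_combination -e1
    · linear_combination e2

/-- The shapes of the collinear rotating configurations: the middle body and the ratio of
distances. -/
def shapes (m Q : Fin 3 → ℝ) : Set (Fin 3 × ℝ) :=
  {s | 0 < s.2 ∧ ∃ lam, IsEuler m Q (normalized m s.1 s.2) lam}

open Classical in
/-- The similarity class with a given shape. -/
def classOfShape (m Q : Fin 3 → ℝ) (s : Fin 3 × ℝ) : Quotient similarity :=
  Quotient.mk similarity (linePoint m (normalized m s.1 s.2)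
    (if h : ∃ lam, IsEuler m Q (normalized m s.1 s.2) lam then h.choose else 0))

/-- The three cyclic differences add up to zero, so two of them have opposite sign to the third; the
body shared by those two is in the middle. -/
theorem exists_middle {x : Fin 3 → ℝ} (hx : Function.Injective x) :
    ∃ k, 0 < (x (k + 2) - x k) / (x k - x (k + 1)) := by
  have h01 := sub_ne_zero.mpr (hx.ne (show (0 : Fin 3) ≠ 1 by decide))
  have h12 := sub_ne_zero.mpr (hx.ne (show (1 : Fin 3) ≠ 2 by decide))
  have h20 := sub_ne_zero.mpr (hx.ne (show (2 : Fin 3) ≠ 0 by decide))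
  by_contra! h
  have h0 := h 0
  have h1 := h 1
  have h2 := h 2
  simp only [Fin.isValue, zero_add, Fin.reduceAdd] at h0 h1 h2
  rcases h01.lt_or_gt with h01 | h01 <;> rcases h12.lt_or_gt with h12 | h12 <;>
    rcases h20.lt_or_gt with h20 | h20 <;>
    first
    | linarith
    | exact absurd (div_pos h20 h01) h0.not_gt
    | exact absurd (div_pos h01 h12) h1.not_gt
    | exact absurd (div_pos h12 h20) h2.not_gt
    | exact absurd (div_pos_of_neg_of_neg h20 h01) h0.not_gt
    | exact absurd (div_pos_of_neg_of_neg h01 h12) h1.not_gt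
    | exact absurd (div_pos_of_neg_of_neg h12 h20) h2.not_gt

theorem exists_eq_smul_normalized {m : Fin 3 → ℝ} (hm : ∀ i, 0 < m i) {x : Fin 3 → ℝ}
    (hx : Function.Injective x) (hC : ∑ i, m i * x i = 0) :
    ∃ (k : Fin 3) (t s : ℝ), 0 < t ∧ s ≠ 0 ∧ x = s • normalized m k t := by
  obtain ⟨k, hk⟩ := exists_middle hx
  have hs : x k - x (k + 1) ≠ 0 := sub_ne_zero.mpr (hx.ne (add_one_ne k).symm)
  refine ⟨k, _, x k - x (k + 1), hk, hs, ?_⟩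
  have hM : 0 < m k + m (k + 1) + m (k + 2) := by
    have := hm k; have := hm (k + 1); have := hm (k + 2); positivity
  rw [sum_cyclic _ k] at hC
  rw [funext_iff, forall_cyclic k]
  simp only [Pi.smul_apply, normalized_self, normalized_add_one, normalized_add_two,
    sum_cyclic m k, smul_eq_mul]
  refine ⟨?_, ?_, ?_⟩
  · field_simp
    linear_combination hC
  · field_simp
    linear_combination hC
  · field_simp
    linear_combination hC

theorem collinearClasses_eq_image {m : Fin 3 → ℝ} (hm : ∀ i, 0 < m i) (Q : Fin 3 → ℝ) :
    collinearClasses m Q = classOfShape m Q '' shapes m Q := by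
  ext c
  constructor
  · rintro ⟨z, ⟨hz, hcol⟩, rfl⟩
    obtain ⟨x, lam, hE, hsim⟩ := hz.exists_isEuler hm hcol
    obtain ⟨k, t, s, ht, hs, rfl⟩ := exists_eq_smul_normalized hm hE.1 hE.sum_mass_mul
    have hs' : s⁻¹ ≠ 0 := inv_ne_zero hs
    have hE' := hE.smul hs'
    have hsim' := hsim.trans (similar_linePoint_smul m (s • normalized m k t) hs')
    rw [inv_smul_smul₀ hs] at hE' hsim'
    have hex : ∃ lam, IsEuler m Q (normalized m k t) lam := ⟨_, hE'⟩
    refine ⟨(k, t), ⟨ht, hex⟩, Quotient.sound ?_⟩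
    simp only [dif_pos hex]
    rw [hex.choose_spec.multiplier_unique hm hE']
    exact hsim'.symm
  · rintro ⟨⟨k, t⟩, ⟨ht, hex⟩, rfl⟩
    refine ⟨_, ?_, rfl⟩
    simp only [dif_pos hex]
    exact hex.choose_spec.isAssociatedToCentral hm

theorem Similar.exists_abs_sub_eq {m x y : Fin 3 → ℝ} {lam mu : ℝ}
    (h : Similar (linePoint m x lam) (linePoint m y mu)) :
    ∃ r : ℝ, ∀ i j, |y i - y j| = r * |x i - x j| := by
  obtain ⟨R, c, -, -, h1, -⟩ := h
  refine ⟨c ^ 2, fun i j => ?_⟩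
  rw [← norm_smul_unitVec_sub _ _ 0, ← norm_smul_unitVec_sub _ _ 0]
  have h2 := h1 i
  have h3 := h1 j
  simp only [linePoint] at h2 h3
  rw [h2, h3, ← smul_sub, norm_smul, ← map_sub, R.norm_map, Real.norm_of_nonneg (sq_nonneg c)]

theorem abs_normalized_sub (m : Fin 3 → ℝ) (k : Fin 3) {t : ℝ} (ht : 0 < t) :
    |normalized m k t k - normalized m k t (k + 1)| = 1 ∧
      |normalized m k t k - normalized m k t (k + 2)| = t ∧
      |normalized m k t (k + 1) - normalized m k t (k + 2)| = 1 + t := by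
  rw [normalized_self, normalized_add_one, normalized_add_two]
  refine ⟨?_, ?_, ?_⟩
  · rw [sub_sub_cancel, abs_one]
  · rw [sub_add_cancel_left, abs_neg, abs_of_pos ht]
  · rw [← abs_neg, show ∀ a b : ℝ, -(a - 1 - (a + b)) = 1 + b by intros; ring,
      abs_of_pos (by positivity)]

/-- Similarity multiplies all distances by one factor. The middle body is opposite the largest
distance, and the other two distances have ratio `t`. -/
theorem injOn_classOfShape (m Q : Fin 3 → ℝ) : Set.InjOn (classOfShape m Q) (shapes m Q) := by
  rintro ⟨k, t⟩ ⟨ht, -⟩ ⟨l, u⟩ ⟨hu, -⟩ h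
  obtain ⟨r, hr⟩ := (show Similar _ _ from Quotient.exact h).exists_abs_sub_eq
  simp only at hr ht hu
  obtain ⟨a1, a2, a3⟩ := abs_normalized_sub m k ht
  obtain ⟨b1, b2, b3⟩ := abs_normalized_sub m l hu
  rw [hr] at b1 b2 b3
  rcases eq_or_eq_add k l with rfl | rfl | rfl
  · rw [a1] at b1
    rw [a2] at b2
    have : r = 1 := by linarith
    rw [this] at b2
    simp at b2
    rw [b2]
  · rw [add_one_add_one] at b1 b3
    rw [add_one_add_two] at b2 b3
    rw [abs_sub_comm, a1] at b2
    rw [a3] at b1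
    rw [abs_sub_comm, a2] at b3
    have : 0 < r := by nlinarith
    nlinarith
  · rw [add_two_add_one] at b1 b3
    rw [add_two_add_two] at b2 b3
    rw [abs_sub_comm, a3] at b2
    rw [abs_sub_comm, a2] at b1
    rw [a1] at b3
    nlinarith

theorem encard_collinearClasses {m : Fin 3 → ℝ} (hm : ∀ i, 0 < m i) (Q : Fin 3 → ℝ) :
    (collinearClasses m Q).encard = (shapes m Q).encard := by
  rw [collinearClasses_eq_image hm, (injOn_classOfShape m Q).encard_image]

/-- The ratios of distances of the collinear rotating configurations with `k` in the middle. -/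
def ratios (m Q : Fin 3 → ℝ) (k : Fin 3) : Set ℝ :=
  {t | IsEulerRatio (m (k + 1)) (m k) (m (k + 2)) (-(Q (k + 1) * Q k))
        (-(Q (k + 1) * Q (k + 2))) (-(Q k * Q (k + 2))) t}

theorem shapes_eq {m : Fin 3 → ℝ} (hm : ∀ i, 0 < m i) (Q : Fin 3 → ℝ) (k : Fin 3) :
    shapes m Q = Prod.mk k '' ratios m Q k ∪ (Prod.mk (k + 1) '' ratios m Q (k + 1) ∪
      Prod.mk (k + 2) '' ratios m Q (k + 2)) := by
  ext ⟨l, t⟩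
  have h1 : (l, t) ∈ shapes m Q ↔ t ∈ ratios m Q l := by
    constructor
    · rintro ⟨ht, h⟩
      exact (exists_isEuler_normalized_iff hm Q l ht).mp h
    · intro h
      exact ⟨h.1, (exists_isEuler_normalized_iff hm Q l h.1).mpr h⟩
  rw [h1]
  simp only [Set.mem_union, Set.mem_image, Prod.mk.injEq]
  constructor
  · rcases eq_or_eq_add k l with rfl | rfl | rfl
    · exact fun h => Or.inl ⟨t, h, rfl, rfl⟩
    · exact fun h => Or.inr (Or.inl ⟨t, h, rfl, rfl⟩)
    · exact fun h => Or.inr (Or.inr ⟨t, h, rfl, rfl⟩)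
  · rintro (⟨_, h, rfl, rfl⟩ | ⟨_, h, rfl, rfl⟩ | ⟨_, h, rfl, rfl⟩) <;> exact h

theorem encard_collinearClasses_eq_add {m : Fin 3 → ℝ} (hm : ∀ i, 0 < m i) (Q : Fin 3 → ℝ)
    (k : Fin 3) : (collinearClasses m Q).encard = (ratios m Q k).encard +
      ((ratios m Q (k + 1)).encard + (ratios m Q (k + 2)).encard) := by
  have hinj : ∀ l : Fin 3, Function.Injective (Prod.mk l : ℝ → Fin 3 × ℝ) := fun l a b h =>
    (Prod.mk.injEq _ _ _ _ ▸ h).2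
  have hdisj : ∀ l l' : Fin 3, l ≠ l' → ∀ s s' : Set ℝ,
      Disjoint (Prod.mk l '' s) (Prod.mk l' '' s') := by
    intro l l' h s s'
    rw [Set.disjoint_left]
    rintro _ ⟨a, -, rfl⟩ ⟨b, -, hb⟩
    exact h (congrArg Prod.fst hb).symm
  rw [encard_collinearClasses hm, shapes_eq hm Q k, Set.encard_union_eq, Set.encard_union_eq,
    (hinj _).encard_image, (hinj _).encard_image, (hinj _).encard_image]
  · exact hdisj _ _ (add_two_ne_add_one k).symm _ _
  · exact Set.disjoint_union_right.mpr ⟨hdisj _ _ (add_one_ne k).symm _ _,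
      hdisj _ _ (add_two_ne k).symm _ _⟩

/-! ### Counting ratios of distances -/

theorem encard_le_two_of_no_three {S : Set ℝ}
    (h : ∀ t ∈ S, ∀ u ∈ S, ∀ v ∈ S, t < u → u < v → False) : S.encard ≤ 2 := by
  by_contra! hS
  have h3 : (3 : ℕ∞) ≤ S.encard := by
    have := Order.add_one_le_of_lt hS
    exact (by norm_num : (3 : ℕ∞) = 2 + 1) ▸ this
  obtain ⟨T, hT, hT3⟩ := Set.exists_subset_encard_eq h3
  obtain ⟨x, y, z, hxy, hxz, hyz, rfl⟩ := Set.encard_eq_three.mp hT3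
  have hx := hT (show x ∈ ({x, y, z} : Set ℝ) by simp)
  have hy := hT (show y ∈ ({x, y, z} : Set ℝ) by simp)
  have hz := hT (show z ∈ ({x, y, z} : Set ℝ) by simp)
  rcases hxy.lt_or_gt with a | a <;> rcases hxz.lt_or_gt with b | b <;>
    rcases hyz.lt_or_gt with c | c
  · exact h x hx y hy z hz a c
  · exact h x hx z hz y hy b c
  · linarith
  · exact h z hz x hx y hy b a
  · exact h y hy x hx z hz a b
  · linarith
  · exact h y hy z hz x hx c b
  · exact h z hz y hy x hx c a

/-- Reversing the order of the bodies. -/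
theorem IsEulerRatio.reverse {m₁ m₂ m₃ g₁₂ g₁₃ g₂₃ t : ℝ} (h₁ : 0 < m₁) (h₂ : 0 < m₂)
    (h₃ : 0 < m₃) (h : IsEulerRatio m₁ m₂ m₃ g₁₂ g₁₃ g₂₃ t) :
    IsEulerRatio m₃ m₂ m₁ g₂₃ g₁₃ g₁₂ t⁻¹ := by
  have ht := h.1
  obtain ⟨lam, hl, e1, e2⟩ := (isEulerRatio_iff_exists h₁ h₂ h₃ _ _ _ ht).mp h
  have ht1 : 0 < 1 + t := by positivity
  refine (isEulerRatio_iff_exists h₃ h₂ h₁ _ _ _ (inv_pos.mpr ht)).mpr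
    -- Reversal also rescales lengths by `t⁻¹`, which multiplies the multiplier by `t ^ 3`.
    ⟨lam * t ^ 3, by positivity, ?_, ?_⟩
  · have : g₂₃ + g₁₃ / (1 + t⁻¹) ^ 2 = t ^ 2 * (g₂₃ / t ^ 2 + g₁₃ / (1 + t) ^ 2) := by
      field_simp; ring
    rw [this, e2]
    field_simp; ring
  · have : g₁₂ / t⁻¹ ^ 2 + g₁₃ / (1 + t⁻¹) ^ 2 = t ^ 2 * (g₁₂ + g₁₃ / (1 + t) ^ 2) := by
      field_simp; ring
    rw [this, e1]
    field_simp; ring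

theorem IsEulerRatio.pos_of_nonpos {m₁ m₂ m₃ g₁₂ g₁₃ g₂₃ t : ℝ} (h₁ : 0 < m₁) (h₂ : 0 < m₂)
    (h₃ : 0 < m₃) (h : IsEulerRatio m₁ m₂ m₃ g₁₂ g₁₃ g₂₃ t) (hg : g₁₃ ≤ 0) :
    0 < g₁₂ ∧ 0 < g₂₃ := by
  have key : ∀ {n₁ n₂ n₃ a b s : ℝ}, IsEulerRatio n₁ n₂ n₃ a g₁₃ b s → 0 < a :=
    fun {_ _ _ a _ s} h => by
      have h1 : 0 < (1 + s) ^ 2 * a := by linarith [h.2.1]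
      exact pos_of_mul_pos_right h1 (sq_nonneg _)
  exact ⟨key h, key (h.reverse h₁ h₂ h₃)⟩

/-- If the outer bodies repel each other, there is at most one ratio. -/
theorem IsEulerRatio.eq_of_nonpos {m₁ m₂ m₃ g₁₂ g₁₃ g₂₃ : ℝ} (h₁ : 0 < m₁) (h₂ : 0 < m₂)
    (h₃ : 0 < m₃) (hg : g₁₃ ≤ 0) {t u : ℝ} (ht : IsEulerRatio m₁ m₂ m₃ g₁₂ g₁₃ g₂₃ t)
    (hu : IsEulerRatio m₁ m₂ m₃ g₁₂ g₁₃ g₂₃ u) : t = u := by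
  have key : ∀ {t u : ℝ}, IsEulerRatio m₁ m₂ m₃ g₁₂ g₁₃ g₂₃ t →
      IsEulerRatio m₁ m₂ m₃ g₁₂ g₁₃ g₂₃ u → ¬ t < u := by
    intro t u ht hu htu
    have ht0 := ht.1
    have hu0 := hu.1
    -- Dividing by `(1 + s) ^ 2` gives a balance whose left force factor is nondecreasing in `s` and
    -- whose right one is nonincreasing, because `g₁₃ ≤ 0`.
    have form : ∀ {s : ℝ}, IsEulerRatio m₁ m₂ m₃ g₁₂ g₁₃ g₂₃ s →
        0 < g₁₂ + g₁₃ * (1 / (1 + s)) ^ 2 ∧ 0 < g₂₃ + g₁₃ * (s / (1 + s)) ^ 2 ∧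
        m₃ * ((1 + s) * m₁ + s * m₂) * s ^ 2 * (g₁₂ + g₁₃ * (1 / (1 + s)) ^ 2) =
          m₁ * (m₂ + (1 + s) * m₃) * (g₂₃ + g₁₃ * (s / (1 + s)) ^ 2) := by
      rintro s ⟨hs, hA, e⟩
      have hs1 : 0 < 1 + s := by positivity
      have a1 : g₁₂ + g₁₃ * (1 / (1 + s)) ^ 2 = ((1 + s) ^ 2 * g₁₂ + g₁₃) / (1 + s) ^ 2 := by
        field_simp
      have a2 : g₂₃ + g₁₃ * (s / (1 + s)) ^ 2 =
          ((1 + s) ^ 2 * g₂₃ + s ^ 2 * g₁₃) / (1 + s) ^ 2 := by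
        field_simp
      have a3 : m₃ * ((1 + s) * m₁ + s * m₂) * s ^ 2 * (g₁₂ + g₁₃ * (1 / (1 + s)) ^ 2) =
          m₁ * (m₂ + (1 + s) * m₃) * (g₂₃ + g₁₃ * (s / (1 + s)) ^ 2) := by
        rw [a1, a2]; field_simp; linear_combination e
      have a4 : 0 < g₁₂ + g₁₃ * (1 / (1 + s)) ^ 2 := by rw [a1]; positivity
      refine ⟨a4, ?_, a3⟩
      have a5 : 0 < m₁ * (m₂ + (1 + s) * m₃) * (g₂₃ + g₁₃ * (s / (1 + s)) ^ 2) := by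
        rw [← a3]; positivity
      exact pos_of_mul_pos_right a5 (by positivity)
    obtain ⟨At, Bt, et⟩ := form ht
    obtain ⟨Au, Bu, eu⟩ := form hu
    have hA : g₁₂ + g₁₃ * (1 / (1 + t)) ^ 2 ≤ g₁₂ + g₁₃ * (1 / (1 + u)) ^ 2 := by
      have : (1 / (1 + u)) ^ 2 ≤ (1 / (1 + t)) ^ 2 := by gcongr
      linarith [mul_le_mul_of_nonpos_left this hg]
    have hB : g₂₃ + g₁₃ * (u / (1 + u)) ^ 2 ≤ g₂₃ + g₁₃ * (t / (1 + t)) ^ 2 := by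
      have h1 : t / (1 + t) ≤ u / (1 + u) := by
        rw [div_le_div_iff₀ (by positivity) (by positivity)]; linarith
      have : (t / (1 + t)) ^ 2 ≤ (u / (1 + u)) ^ 2 := by gcongr
      linarith [mul_le_mul_of_nonpos_left this hg]
    set A := g₁₂ + g₁₃ * (1 / (1 + t)) ^ 2
    set A' := g₁₂ + g₁₃ * (1 / (1 + u)) ^ 2
    set B := g₂₃ + g₁₃ * (t / (1 + t)) ^ 2
    set B' := g₂₃ + g₁₃ * (u / (1 + u)) ^ 2
    -- The quotient of the two mass factors is a Möbius function of the ratio; it increases because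
    -- its determinant, up to a positive factor, is `(m₁ + m₂) * (m₂ + m₃) - m₁ * m₃ > 0`.
    have hp : m₃ * ((1 + t) * m₁ + t * m₂) * (m₁ * (m₂ + (1 + u) * m₃)) <
        m₃ * ((1 + u) * m₁ + u * m₂) * (m₁ * (m₂ + (1 + t) * m₃)) := by
      have : 0 < (u - t) * (m₃ * m₁ * ((m₁ + m₂) * (m₂ + m₃) - m₁ * m₃)) := by
        have h1 : 0 < u - t := by linarith
        have h2 : (m₁ + m₂) * (m₂ + m₃) - m₁ * m₃ = m₁ * m₂ + m₂ * m₂ + m₂ * m₃ := by ring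
        rw [h2]; positivity
      linarith
    have hp' : m₃ * ((1 + t) * m₁ + t * m₂) * t ^ 2 * (m₁ * (m₂ + (1 + u) * m₃)) <
        m₃ * ((1 + u) * m₁ + u * m₂) * u ^ 2 * (m₁ * (m₂ + (1 + t) * m₃)) := by
      have h1 : t ^ 2 < u ^ 2 := by gcongr
      have h2 := mul_lt_mul'' hp h1 (by positivity) (by positivity)
      linarith
    have hAB : A * B' ≤ A' * B := mul_le_mul hA hB Bu.le Au.le
    have h2 := mul_lt_mul_of_pos_of_nonneg' hp' hAB (mul_pos At Bu) (by positivity)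
    have h3 : m₃ * ((1 + t) * m₁ + t * m₂) * t ^ 2 * (m₁ * (m₂ + (1 + u) * m₃)) * (A * B') =
        m₃ * ((1 + u) * m₁ + u * m₂) * u ^ 2 * (m₁ * (m₂ + (1 + t) * m₃)) * (A' * B) := by
      linear_combination (m₁ * (m₂ + (1 + u) * m₃)) * B' * et -
        (m₁ * (m₂ + (1 + t) * m₃)) * B * eu
    linarith
  exact le_antisymm (not_lt.mp (key hu ht)) (not_lt.mp (key ht hu))

/-- A quintic whose coefficients are nonnegative except the quadratic one is negative between two
positive zeros. -/
theorem quintic_neg_of_between {c₀ c₁ c₂ c₃ c₄ c₅ : ℝ} (h0 : 0 ≤ c₀) (h1 : 0 ≤ c₁) (h4 : 0 ≤ c₄)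
    (h5 : 0 < c₅) {P : ℝ → ℝ}
    (hP : ∀ x, P x = c₅ * x ^ 5 + c₄ * x ^ 4 + c₃ * x ^ 3 + c₂ * x ^ 2 + c₁ * x + c₀) {t u v : ℝ}
    (ht : 0 < t) (htu : t < u) (huv : u < v) (et : P t = 0) (ev : P v = 0) : P u < 0 := by
  have hu : 0 < u := ht.trans htu
  have hv : 0 < v := hu.trans huv
  -- Second divided difference of `P x / x ^ 2`, denominators cleared. The part `c₃ * x + c₂` is
  -- affine and drops out, so `c₂` and `c₃` may have any sign; the rest is strictly convex for `x >
  -- 0`.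
  have key : P t * (u ^ 2 * v ^ 2 * (v - u)) - P u * (t ^ 2 * v ^ 2 * (v - t)) +
      P v * (t ^ 2 * u ^ 2 * (u - t)) = (v - u) * (v - t) * (u - t) *
        (t ^ 2 * u ^ 2 * v ^ 2 * (c₅ * (t + u + v) + c₄) + c₁ * (t * u * v) +
          c₀ * (u * v + t * v + t * u)) := by
    rw [hP, hP, hP]; ring
  rw [et, ev] at key
  have a : 0 < v - u := by linarith
  have b : 0 < v - t := by linarith
  have c : 0 < u - t := by linarith
  have h : 0 < (v - u) * (v - t) * (u - t) *
        (t ^ 2 * u ^ 2 * v ^ 2 * (c₅ * (t + u + v) + c₄) + c₁ * (t * u * v) +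
          c₀ * (u * v + t * v + t * u)) := by positivity
  have hw : 0 < t ^ 2 * v ^ 2 * (v - t) := by positivity
  by_contra! hn
  have := mul_nonneg hn hw.le
  linarith

/-- Euler's quintic. -/
def eulerPoly (m₁ m₂ m₃ g₁₂ g₁₃ g₂₃ t : ℝ) : ℝ :=
  m₃ * ((1 + t) * m₁ + t * m₂) * (t ^ 2 * ((1 + t) ^ 2 * g₁₂ + g₁₃)) -
      m₁ * (m₂ + (1 + t) * m₃) * ((1 + t) ^ 2 * g₂₃ + t ^ 2 * g₁₃)

theorem IsEulerRatio.eulerPoly_eq_zero {m₁ m₂ m₃ g₁₂ g₁₃ g₂₃ t : ℝ}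
    (h : IsEulerRatio m₁ m₂ m₃ g₁₂ g₁₃ g₂₃ t) : eulerPoly m₁ m₂ m₃ g₁₂ g₁₃ g₂₃ t = 0 :=
  sub_eq_zero.mpr h.2.2

/-- The sign of `g₁₃` does not matter: it enters only the quadratic and cubic coefficients, on which
`quintic_neg_of_between` imposes nothing. -/
theorem eulerPoly_neg_of_between {m₁ m₂ m₃ g₁₂ g₁₃ g₂₃ : ℝ} (h₁ : 0 < m₁) (h₂ : 0 < m₂)
    (h₃ : 0 < m₃) (h12 : 0 < g₁₂) (h23 : g₂₃ < 0) {t u v : ℝ} (ht : 0 < t) (htu : t < u)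
    (huv : u < v) (et : eulerPoly m₁ m₂ m₃ g₁₂ g₁₃ g₂₃ t = 0)
    (ev : eulerPoly m₁ m₂ m₃ g₁₂ g₁₃ g₂₃ v = 0) : eulerPoly m₁ m₂ m₃ g₁₂ g₁₃ g₂₃ u < 0 := by
  have h23' : 0 < -g₂₃ := by linarith
  refine quintic_neg_of_between (c₀ := -g₂₃ * m₁ * (m₂ + m₃))
    (c₁ := -g₂₃ * m₁ * (m₃ + 2 * (m₂ + m₃)))
    (c₂ := g₁₂ * m₃ * m₁ - g₁₃ * m₁ * m₂ - g₂₃ * m₁ * (m₂ + 3 * m₃))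
    (c₃ := g₁₂ * m₃ * (3 * m₁ + m₂) + g₁₃ * m₂ * m₃ - g₂₃ * m₁ * m₃)
    (c₄ := g₁₂ * m₃ * (3 * m₁ + 2 * m₂)) (c₅ := g₁₂ * m₃ * (m₁ + m₂))
    (by positivity) (by positivity) (by positivity) (by positivity) (fun x => ?_) ht htu huv et ev
  unfold eulerPoly; ring

theorem encard_eulerRatio_le_two {m₁ m₂ m₃ g₁₂ g₁₃ g₂₃ : ℝ} (h₁ : 0 < m₁) (h₂ : 0 < m₂)
    (h₃ : 0 < m₃) (h12 : 0 < g₁₂) (h23 : g₂₃ < 0) :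
    {t | IsEulerRatio m₁ m₂ m₃ g₁₂ g₁₃ g₂₃ t}.encard ≤ 2 := by
  refine encard_le_two_of_no_three fun t ht u hu v hv htu huv => ?_
  have := eulerPoly_neg_of_between h₁ h₂ h₃ h12 h23 ht.1 htu huv ht.eulerPoly_eq_zero
    hv.eulerPoly_eq_zero
  rw [hu.eulerPoly_eq_zero] at this
  exact this.false

/-- The terms `m₁ * m₃ * (1 + t) * g₁₃` cancel in the quintic; dropping the `g₂₃` terms, of known
sign, leaves the inequality. For an opposite charge at the end `1`, it says that the middle body has
a smaller charge-to-mass ratio than the other end. -/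
theorem IsEulerRatio.mul_lt_mul {m₁ m₂ m₃ g₁₂ g₁₃ g₂₃ t : ℝ} (h₁ : 0 < m₁) (h₂ : 0 < m₂)
    (h₃ : 0 < m₃) (h12 : 0 < g₁₂) (h13 : 0 < g₁₃) (h23 : g₂₃ < 0)
    (h : IsEulerRatio m₁ m₂ m₃ g₁₂ g₁₃ g₂₃ t) : g₁₂ * m₃ < g₁₃ * m₂ := by
  have ht := h.1
  have e := h.2.2
  have h23' : 0 < -g₂₃ := by linarith
  have a1 : 0 < -g₂₃ * (m₁ * (m₂ + (1 + t) * m₃) * (1 + t) ^ 2) := by positivity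
  have a2 : t ^ 2 * (g₁₂ * m₃ * ((1 + t) ^ 2 * ((1 + t) * m₁ + t * m₂)) + g₁₃ * m₂ * (m₃ * t)) <
      t ^ 2 * (g₁₃ * m₂ * m₁) := by linarith
  have a3 := lt_of_mul_lt_mul_left a2 (sq_nonneg t)
  have a4 : g₁₂ * m₃ * m₁ ≤ g₁₂ * m₃ * ((1 + t) ^ 2 * ((1 + t) * m₁ + t * m₂)) := by
    have : m₁ ≤ (1 + t) ^ 2 * ((1 + t) * m₁ + t * m₂) := by
      have : 0 ≤ (1 + t) ^ 2 * ((1 + t) * m₁ + t * m₂) - m₁ := by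
        have e : (1 + t) ^ 2 * ((1 + t) * m₁ + t * m₂) - m₁ =
          (3 * t + 3 * t ^ 2 + t ^ 3) * m₁ + (1 + t) ^ 2 * (t * m₂) := by ring
        rw [e]; positivity
      linarith
    gcongr
  have a5 : 0 < g₁₃ * m₂ * (m₃ * t) := by positivity
  have a6 : m₁ * (g₁₂ * m₃) < m₁ * (g₁₃ * m₂) := by linarith
  exact lt_of_mul_lt_mul_left a6 h₁.le

theorem eulerRatio_reverse_encard_le {m₁ m₂ m₃ g₁₂ g₁₃ g₂₃ : ℝ} (h₁ : 0 < m₁) (h₂ : 0 < m₂)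
    (h₃ : 0 < m₃) : {t | IsEulerRatio m₁ m₂ m₃ g₁₂ g₁₃ g₂₃ t}.encard ≤
      {t | IsEulerRatio m₃ m₂ m₁ g₂₃ g₁₃ g₁₂ t}.encard := by
  rw [← (inv_injective (G := ℝ)).encard_image]
  refine Set.encard_le_encard ?_
  rintro _ ⟨t, ht, rfl⟩
  exact IsEulerRatio.reverse h₁ h₂ h₃ ht

/-! ### The upper bound for the number of classes -/

variable {m Q : Fin 3 → ℝ}

theorem encard_ratios_le_one (hm : ∀ i, 0 < m i) {k : Fin 3} (h : 0 ≤ Q (k + 1) * Q (k + 2)) :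
    (ratios m Q k).encard ≤ 1 :=
  Set.encard_le_one_iff.mpr fun _ _ ht hu =>
    IsEulerRatio.eq_of_nonpos (hm _) (hm _) (hm _) (neg_nonpos.mpr h) ht hu

theorem encard_ratios_add_two_le (hm : ∀ i, 0 < m i) {k : Fin 3} (h2 : Q k * Q (k + 2) < 0)
    (h12 : 0 < Q (k + 1) * Q (k + 2)) : (ratios m Q (k + 2)).encard ≤ 2 := by
  simp only [ratios, add_two_add_one, add_two_add_two]
  exact encard_eulerRatio_le_two (hm _) (hm _) (hm _) (by linarith) (by linarith)

theorem encard_ratios_add_one_le (hm : ∀ i, 0 < m i) {k : Fin 3} (h1 : Q k * Q (k + 1) < 0)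
    (h12 : 0 < Q (k + 1) * Q (k + 2)) : (ratios m Q (k + 1)).encard ≤ 2 := by
  simp only [ratios, add_one_add_one, add_one_add_two]
  refine (eulerRatio_reverse_encard_le (hm _) (hm _) (hm _)).trans ?_
  exact encard_eulerRatio_le_two (hm _) (hm _) (hm _) (by linarith) (by linarith)

theorem ratios_add_two_eq_empty (hm : ∀ i, 0 < m i) {k : Fin 3} (h1 : Q k * Q (k + 1) < 0)
    (h2 : Q k * Q (k + 2) < 0) (h12 : 0 < Q (k + 1) * Q (k + 2))
    (h : -(Q k * Q (k + 1)) * m (k + 2) ≤ -(Q k * Q (k + 2)) * m (k + 1)) :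
    ratios m Q (k + 2) = ∅ := by
  refine Set.eq_empty_of_forall_notMem fun t ht => h.not_gt ?_
  simp only [ratios, add_two_add_one, add_two_add_two, Set.mem_ofPred_eq] at ht
  exact ht.mul_lt_mul (hm _) (hm _) (hm _) (by linarith) (by linarith) (by linarith)

theorem ratios_add_one_eq_empty (hm : ∀ i, 0 < m i) {k : Fin 3} (h1 : Q k * Q (k + 1) < 0)
    (h2 : Q k * Q (k + 2) < 0) (h12 : 0 < Q (k + 1) * Q (k + 2))
    (h : -(Q k * Q (k + 2)) * m (k + 1) ≤ -(Q k * Q (k + 1)) * m (k + 2)) :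
    ratios m Q (k + 1) = ∅ := by
  refine Set.eq_empty_of_forall_notMem fun t ht => h.not_gt ?_
  simp only [ratios, add_one_add_one, add_one_add_two, Set.mem_ofPred_eq] at ht
  have := (ht.reverse (hm _) (hm _) (hm _)).mul_lt_mul (hm _) (hm _) (hm _) (by linarith)
    (by linarith) (by linarith)
  linarith

/-- Unless one charge is opposite to both others, only neutral bodies occur in the middle. -/
theorem neutral_of_mem_ratios (hm : ∀ i, 0 < m i)
    (hQ : ¬ ∃ k, Q k * Q (k + 1) < 0 ∧ Q k * Q (k + 2) < 0) {k : Fin 3} {t : ℝ}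
    (ht : t ∈ ratios m Q k) : Q k = 0 ∧ Q (k + 1) * Q (k + 2) < 0 := by
  push Not at hQ
  -- If the outer bodies did not attract each other, the middle one would have to attract both,
  -- which `hQ` forbids.
  have h13 : Q (k + 1) * Q (k + 2) < 0 := by
    by_contra! h
    have := IsEulerRatio.pos_of_nonpos (hm _) (hm _) (hm _) ht (neg_nonpos.mpr h)
    have := hQ k (by linarith)
    linarith
  refine ⟨?_, h13⟩
  have h1 := hQ (k + 1)
  have h2 := hQ (k + 2)
  rw [add_one_add_one, add_one_add_two] at h1
  rw [add_two_add_one, add_two_add_two] at h2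
  have h3 := h1 h13
  have h4 : 0 ≤ Q (k + 2) * Q k := by
    by_contra! h
    have := h2 h
    linarith
  have h5 := mul_nonneg h3 h4
  have h6 : Q k ^ 2 * (Q (k + 1) * Q (k + 2)) = Q (k + 1) * Q k * (Q (k + 2) * Q k) := by ring
  by_contra h0
  have := mul_neg_of_pos_of_neg (sq_pos_of_ne_zero h0) h13
  linarith

theorem IsEulerRatio.eq_of_eq_zero {m₁ m₂ m₃ g₁₃ t : ℝ} (h₂ : 0 < m₂) (h₃ : 0 < m₃)
    (h : IsEulerRatio m₁ m₂ m₃ 0 g₁₃ 0 t) : t = m₁ / m₃ := by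
  obtain ⟨ht, hg, e⟩ := h
  have hg' : 0 < g₁₃ := by linarith
  rw [eq_div_iff h₃.ne']
  have : g₁₃ * t ^ 2 * m₂ ≠ 0 := by positivity
  refine mul_left_cancel₀ this ?_
  linear_combination e

theorem encard_collinearClasses_le_three (hm : ∀ i, 0 < m i) (Q : Fin 3 → ℝ) :
    (collinearClasses m Q).encard ≤ 3 := by
  by_cases hQ : ∃ k, Q k * Q (k + 1) < 0 ∧ Q k * Q (k + 2) < 0
  · obtain ⟨k, h1, h2⟩ := hQ
    have h12 : 0 < Q (k + 1) * Q (k + 2) := by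
      have h3 := mul_pos_of_neg_of_neg h1 h2
      have h4 : Q k * Q (k + 1) * (Q k * Q (k + 2)) = Q k ^ 2 * (Q (k + 1) * Q (k + 2)) := by ring
      rw [h4] at h3
      exact pos_of_mul_pos_right h3 (sq_nonneg _)
    rw [encard_collinearClasses_eq_add hm Q k]
    have a0 := encard_ratios_le_one hm h12.le
    have e3 : (3 : ℕ∞) = 1 + (0 + 2) := by norm_num
    have e3' : (3 : ℕ∞) = 1 + (2 + 0) := by norm_num
    -- Comparing charge-to-mass ratios of the two like charges rules out one of them as the middle
    -- body.
    rcases le_total (-(Q k * Q (k + 1)) * m (k + 2)) (-(Q k * Q (k + 2)) * m (k + 1)) with h | h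
    · rw [ratios_add_two_eq_empty hm h1 h2 h12 h, Set.encard_empty, e3']
      exact add_le_add a0 (add_le_add (encard_ratios_add_one_le hm h1 h12) le_rfl)
    · rw [ratios_add_one_eq_empty hm h1 h2 h12 h, Set.encard_empty, e3]
      exact add_le_add a0 (add_le_add le_rfl (encard_ratios_add_two_le hm h2 h12))
  · by_cases hne : ∃ k, (ratios m Q k).Nonempty
    · obtain ⟨k, t, ht⟩ := hne
      obtain ⟨hk, h12⟩ := neutral_of_mem_ratios hm hQ ht
      have e1 : ratios m Q (k + 1) = ∅ := Set.eq_empty_of_forall_notMem fun u hu => by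
        have := (neutral_of_mem_ratios hm hQ hu).1
        simp [this] at h12
      have e2 : ratios m Q (k + 2) = ∅ := Set.eq_empty_of_forall_notMem fun u hu => by
        have := (neutral_of_mem_ratios hm hQ hu).1
        simp [this] at h12
      rw [encard_collinearClasses_eq_add hm Q k, e1, e2, Set.encard_empty, add_zero, add_zero]
      refine le_trans (Set.encard_le_one_iff.mpr fun a b ha hb => ?_)
        (by norm_num : (1 : ℕ∞) ≤ 3)
      simp only [ratios, hk, mul_zero, zero_mul, neg_zero, Set.mem_ofPred_eq] at ha hb
      rw [ha.eq_of_eq_zero (hm _) (hm _), hb.eq_of_eq_zero (hm _) (hm _)]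
    · have e : ∀ k, ratios m Q k = ∅ := fun k =>
        Set.not_nonempty_iff_eq_empty.mp fun h => hne ⟨k, h⟩
      simp [encard_collinearClasses_eq_add hm Q 0, e]

/-! ### Charges with prescribed numbers of similarity classes -/

theorem isEulerRatio_smul_iff {m₁ m₂ m₃ g₁₂ g₁₃ g₂₃ t c : ℝ} (hc : 0 < c) :
    IsEulerRatio m₁ m₂ m₃ (c * g₁₂) (c * g₁₃) (c * g₂₃) t ↔
      IsEulerRatio m₁ m₂ m₃ g₁₂ g₁₃ g₂₃ t := by
  unfold IsEulerRatio
  refine and_congr_right fun _ => and_congr ?_ ?_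
  · rw [show (1 + t) ^ 2 * (c * g₁₂) + c * g₁₃ = c * ((1 + t) ^ 2 * g₁₂ + g₁₃) by ring]
    exact mul_pos_iff_of_pos_left hc
  · refine ⟨fun h => mul_left_cancel₀ hc.ne' ?_, fun h => ?_⟩
    · linear_combination h
    · linear_combination c * h

theorem continuous_eulerPoly (m₁ m₂ m₃ g₁₂ g₁₃ g₂₃ : ℝ) :
    Continuous (eulerPoly m₁ m₂ m₃ g₁₂ g₁₃ g₂₃) := by
  unfold eulerPoly; fun_prop

/-- A ratio exists when the middle body dominates. -/
theorem exists_isEulerRatio {m₁ m₂ m₃ b c : ℝ} (h₁ : 0 < m₁) (h₂ : 0 < m₂) (h₃ : 0 < m₃)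
    (hb0 : 0 < b) (hb : b ≤ 1) (hc : 0 < c) : ∃ t, IsEulerRatio m₁ m₂ m₃ 1 (-b) c t := by
  have hd : 0 < c * (m₂ + 2 * m₃) / m₃ := by positivity
  -- Chosen so large that `m₃ * t ^ 3` exceeds `c * (m₂ + (1 + t) * m₃)`, which makes the quintic
  -- positive there.
  set t := 1 + c * (m₂ + 2 * m₃) / m₃ with ht
  have ht1 : 1 < t := by linarith
  have ht0 : 0 < t := by linarith
  have htm : m₃ * t = m₃ + c * (m₂ + 2 * m₃) := by rw [ht]; field_simp
  have hneg : eulerPoly m₁ m₂ m₃ 1 (-b) c 0 < 0 := by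
    have : eulerPoly m₁ m₂ m₃ 1 (-b) c 0 = -(m₁ * (m₂ + m₃) * c) := by unfold eulerPoly; ring
    rw [this, neg_lt_zero]; positivity
  have hpos : 0 < eulerPoly m₁ m₂ m₃ 1 (-b) c t := by
    have e : eulerPoly m₁ m₂ m₃ 1 (-b) c t =
        (1 + t) ^ 2 * (m₁ * (m₃ * t * t ^ 2 - c * (m₂ + (1 + t) * m₃))) +
        (1 + t) ^ 2 * m₃ * m₁ * t ^ 2 + t ^ 3 * m₂ * m₃ * ((1 + t) ^ 2 - b) +
        b * m₁ * m₂ * t ^ 2 := by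
      unfold eulerPoly; ring
    have a1 : 0 < (1 + t) ^ 2 - b := by nlinarith
    have a2 : 0 < m₃ * t * t ^ 2 - c * (m₂ + (1 + t) * m₃) := by
      rw [htm]
      have b1 : t ≤ t ^ 2 := by nlinarith
      have b2 : (m₃ + c * (m₂ + 2 * m₃)) * t ≤ (m₃ + c * (m₂ + 2 * m₃)) * t ^ 2 := by gcongr
      have b3 : 0 < m₃ * t := by positivity
      have b4 : c * (m₂ + m₃) * 1 ≤ c * (m₂ + m₃) * t := by gcongr
      linarith
    rw [e]; positivity
  obtain ⟨s, hs, hs0⟩ := intermediate_value_Icc ht0.le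
    (continuous_eulerPoly m₁ m₂ m₃ 1 (-b) c).continuousOn ⟨hneg.le, hpos.le⟩
  have hs' : 0 < s := by
    refine lt_of_le_of_ne hs.1 ?_
    rintro rfl
    rw [hs0] at hneg
    exact hneg.false
  exact ⟨s, hs', by nlinarith, sub_eq_zero.mp hs0⟩

/-- With an opposite charge at one end, each of the numbers `0`, `1`, `2` of ratios occurs. -/
theorem exists_encard_eulerRatio {m₁ m₂ m₃ β : ℝ} (h₁ : 0 < m₁) (h₂ : 0 < m₂) (h₃ : 0 < m₃)
    (hβ : 0 < β) (hβm : β * m₃ < m₂) (n : ℕ) (hn : n ≤ 2) :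
    ∃ b : ℝ, 0 < b ∧ b ≤ 1 ∧ {t | IsEulerRatio m₁ m₂ m₃ β 1 (-b) t}.encard = n := by
  have hiff : ∀ {b t : ℝ}, IsEulerRatio m₁ m₂ m₃ β 1 (-b) t ↔
      0 < t ∧ eulerPoly m₁ m₂ m₃ β 1 (-b) t = 0 := by
    intro b t
    refine ⟨fun h => ⟨h.1, h.eulerPoly_eq_zero⟩, fun h => ⟨h.1, by positivity, ?_⟩⟩
    exact sub_eq_zero.mp h.2
  -- the polynomial is affine in `b`
  set U : ℝ → ℝ := eulerPoly m₁ m₂ m₃ β 1 0 with hU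
  set W : ℝ → ℝ := fun t => m₁ * (m₂ + (1 + t) * m₃) * (1 + t) ^ 2 with hW
  have hPU : ∀ b t, eulerPoly m₁ m₂ m₃ β 1 (-b) t = U t + b * W t := fun b t => by
    simp only [hU, hW, eulerPoly]; ring
  have hWpos : ∀ t, 0 ≤ t → 0 < W t := fun t ht => by simp only [hW]; positivity
  have hUe : ∀ t, U t = t ^ 2 * (β * m₃ * ((1 + t) ^ 2 * ((1 + t) * m₁ + t * m₂)) -
      m₂ * (m₁ - m₃ * t)) := fun t => by simp only [hU, eulerPoly]; ring
  set T := m₁ / m₃ with hT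
  have hT0 : 0 < T := by positivity
  have hTm : m₃ * T = m₁ := by rw [hT]; field_simp
  have hUpos : ∀ t, T ≤ t → 0 < U t := fun t ht => by
    have ht0 : 0 < t := hT0.trans_le ht
    have : 0 ≤ m₃ * t - m₁ := by
      rw [← hTm]; linarith [mul_le_mul_of_nonneg_left ht h₃.le]
    have e : U t = t ^ 2 * (β * m₃ * ((1 + t) ^ 2 * ((1 + t) * m₁ + t * m₂)) +
      m₂ * (m₃ * t - m₁)) := by rw [hUe]; ring
    rw [e]; positivity
  have hU0 : U 0 = 0 := by rw [hUe]; ring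
  have hU1 : ∀ t, 0 ≤ t → 0 < U t + W t := fun t ht => by
    have e : U t + W t = t ^ 2 * (β * m₃ * ((1 + t) ^ 2 * ((1 + t) * m₁ + t * m₂)) +
        m₂ * (m₃ * t)) + m₁ * m₂ * (1 + 2 * t) + m₁ * ((1 + t) * m₃) * (1 + t) ^ 2 := by
      rw [hUe]; simp only [hW]; ring
    rw [e]; positivity
  have hcont : Continuous U := continuous_eulerPoly _ _ _ _ _ _
  have hcontW : Continuous W := by simp only [hW]; fun_prop
  -- The ratios for the parameter `b` are the positive solutions of `h t = b`. The function vanishes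
  -- at `0`, is negative from `T` on and stays below `1`; its maximum decides the count.
  set h : ℝ → ℝ := fun t => -U t / W t with hh
  have hcontH : ContinuousOn h (Set.Icc 0 T) :=
    hcont.neg.continuousOn.div hcontW.continuousOn fun t ht => (hWpos t ht.1).ne'
  obtain ⟨s, hs, hmax⟩ := isCompact_Icc.exists_isMaxOn (Set.nonempty_Icc.mpr hT0.le) hcontH
  -- the maximum is positive
  have hneg : ∃ t, 0 < t ∧ t ≤ T ∧ U t < 0 := by
    -- This is `U t / t ^ 2` extended to `0`, where `β * m₃ < m₂` makes it negative.
    set g : ℝ → ℝ := fun t => β * m₃ * ((1 + t) ^ 2 * ((1 + t) * m₁ + t * m₂)) -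
      m₂ * (m₁ - m₃ * t) with hg
    have hg0 : g 0 < 0 := by
      have : g 0 = m₁ * (β * m₃ - m₂) := by simp only [hg]; ring
      rw [this]
      exact mul_neg_of_pos_of_neg h₁ (by linarith)
    have hgc : ContinuousAt g 0 := by
      have : Continuous g := by simp only [hg]; fun_prop
      exact this.continuousAt
    obtain ⟨ε, hε, hball⟩ := Metric.eventually_nhds_iff.mp (hgc.eventually_lt_const hg0)
    refine ⟨min (ε / 2) T, by positivity, min_le_right _ _, ?_⟩
    have hp : 0 < min (ε / 2) T := by positivity
    have := hball (y := min (ε / 2) T) (by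
      rw [Real.dist_eq, sub_zero, abs_of_pos hp]
      exact (min_le_left _ _).trans_lt (by linarith))
    rw [hUe]
    exact mul_neg_of_pos_of_neg (by positivity) this
  have hHpos : 0 < h s := by
    obtain ⟨t, ht0, htT, htU⟩ := hneg
    have h1 : h t ≤ h s := hmax ⟨ht0.le, htT⟩
    have h2 : 0 < h t := div_pos (by linarith) (hWpos t ht0.le)
    linarith
  have hs0 : 0 < s := by
    refine lt_of_le_of_ne hs.1 ?_
    rintro rfl
    simp [hh, hU0] at hHpos
  have hUs : U s = -(h s * W s) := by
    have := (hWpos s hs.1).ne'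
    simp only [hh]; field_simp
  have hsT : s < T := by
    refine lt_of_le_of_ne hs.2 ?_
    intro hsT
    have h1 := hUpos s hsT.ge
    have h2 := mul_pos hHpos (hWpos s hs.1)
    linarith
  have hH1 : h s < 1 := by
    have h1 := hU1 s hs.1
    simp only [hh]
    rw [div_lt_one (hWpos s hs.1)]
    linarith
  have hge : ∀ t, 0 < t → 0 ≤ U t + h s * W t := fun t ht => by
    rcases le_total t T with htT | htT
    · have h1 : h t ≤ h s := hmax ⟨ht.le, htT⟩
      have h2 : -U t ≤ h s * W t := (div_le_iff₀ (hWpos t ht.le)).mp h1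
      linarith
    · have h1 := hUpos t htT
      have h2 := mul_pos hHpos (hWpos t ht.le)
      linarith
  interval_cases n
  · refine ⟨1, one_pos, le_rfl, ?_⟩
    rw [Nat.cast_zero, Set.encard_eq_zero]
    refine Set.eq_empty_of_forall_notMem fun t ht => ?_
    have h1 := hiff.mp ht
    rw [hPU, one_mul] at h1
    exact (hU1 t h1.1.le).ne' h1.2
  · refine ⟨h s, hHpos, hH1.le, ?_⟩
    have hmem : IsEulerRatio m₁ m₂ m₃ β 1 (-h s) s :=
      hiff.mpr ⟨hs0, by rw [hPU, hUs]; ring⟩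
    -- At the maximal `b` the quintic is nonnegative for positive arguments, yet it would be
    -- negative between two zeros.
    have key : ∀ t u, IsEulerRatio m₁ m₂ m₃ β 1 (-h s) t →
        IsEulerRatio m₁ m₂ m₃ β 1 (-h s) u → ¬ t < u := by
      intro t u ht hu htu
      have h1 := eulerPoly_neg_of_between h₁ h₂ h₃ hβ (neg_lt_zero.mpr hHpos) ht.1
        (show t < (t + u) / 2 by linarith) (show (t + u) / 2 < u by linarith)
        ht.eulerPoly_eq_zero hu.eulerPoly_eq_zero
      rw [hPU] at h1
      exact h1.not_ge (hge _ (by linarith [ht.1, hu.1]))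
    rw [Nat.cast_one, Set.encard_eq_one]
    refine ⟨s, Set.eq_singleton_iff_unique_mem.mpr ⟨hmem, fun t ht => ?_⟩⟩
    exact le_antisymm (not_lt.mp (key s t hmem ht)) (not_lt.mp (key t s ht hmem))
  -- Below the maximum the quintic is negative at `s` but positive at `0` and `T`, giving a zero on
  -- either side.
  · refine ⟨h s / 2, by linarith, by linarith, ?_⟩
    refine le_antisymm ?_ ?_
    · exact encard_eulerRatio_le_two h₁ h₂ h₃ hβ (by linarith)
    · have hPs : eulerPoly m₁ m₂ m₃ β 1 (-(h s / 2)) s < 0 := by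
        have := mul_pos hHpos (hWpos s hs.1)
        rw [hPU, hUs]; linarith
      have hP0 : 0 < eulerPoly m₁ m₂ m₃ β 1 (-(h s / 2)) 0 := by
        have := mul_pos hHpos (hWpos 0 le_rfl)
        rw [hPU, hU0]; linarith
      have hPT : 0 < eulerPoly m₁ m₂ m₃ β 1 (-(h s / 2)) T := by
        have := mul_pos hHpos (hWpos T hT0.le)
        have := hUpos T le_rfl
        rw [hPU]; linarith
      have hc := continuous_eulerPoly m₁ m₂ m₃ β 1 (-(h s / 2))
      obtain ⟨x, hx, hx0⟩ := intermediate_value_Ioo' hs0.le hc.continuousOn ⟨hPs, hP0⟩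
      obtain ⟨y, hy, hy0⟩ := intermediate_value_Ioo hsT.le hc.continuousOn ⟨hPs, hPT⟩
      have hxy : x ≠ y := (hx.2.trans hy.1).ne
      rw [Nat.cast_ofNat, ← Set.encard_pair hxy]
      refine Set.encard_le_encard ?_
      rintro z (rfl | rfl)
      · exact hiff.mpr ⟨hx.1, hx0⟩
      · exact hiff.mpr ⟨hs0.trans hy.1, hy0⟩

theorem exists_encard_collinearClasses {m : Fin 3 → ℝ} (hm : ∀ i, 0 < m i) (n : ℕ) (hn : n ≤ 3) :
    ∃ Q : Fin 3 → ℝ, (∀ i, Q i ≠ 0) ∧ (collinearClasses m Q).encard = n := by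
  rcases n with _ | n
  · refine ⟨fun _ => 1, fun _ => one_ne_zero, ?_⟩
    have e : ∀ k, ratios m (fun _ => 1) k = ∅ := fun k =>
      Set.eq_empty_of_forall_notMem fun t ht =>
        one_ne_zero (neutral_of_mem_ratios hm (by norm_num) ht).1
    simp [encard_collinearClasses_eq_add hm _ 0, e]
  · have h0 := hm 0
    have h1 := hm 1
    have h2 := hm 2
    have hβ : 0 < m 2 / (2 * m 1) := by positivity
    have hβm : m 2 / (2 * m 1) * m 1 < m 2 := by
      have : m 2 / (2 * m 1) * m 1 = m 2 / 2 := by field_simp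
      linarith
    obtain ⟨b, hb0, hb1, hb⟩ := exists_encard_eulerRatio h0 h2 h1 hβ hβm n (by omega)
    set β := m 2 / (2 * m 1)
    -- With body `2` in the middle the strengths are `b / β` times `β, 1, -b`, giving `n` ratios.
    -- With body `0` they are `b / β` times `1, -b, β`, giving one, and body `1` gives none since `β
    -- * m 1 < m 2`.
    set Q : Fin 3 → ℝ := ![-1, b / β, b] with hQ
    have q0 : Q 0 = -1 := rfl
    have q1 : Q 1 = b / β := rfl
    have q2 : Q 2 = b := rfl
    have hbβ : 0 < b / β := by positivity
    have hs01 : Q 0 * Q (0 + 1) < 0 := by rw [zero_add, q0, q1]; linarith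
    have hs02 : Q 0 * Q (0 + 2) < 0 := by rw [zero_add, q0, q2]; linarith
    have hs12 : 0 < Q (0 + 1) * Q (0 + 2) := by
      rw [zero_add, zero_add, q1, q2]; positivity
    refine ⟨Q, ?_, ?_⟩
    · intro i
      fin_cases i
      · change Q 0 ≠ 0
        rw [q0]; norm_num
      · exact hbβ.ne'
      · exact hb0.ne'
    · have e1 : ratios m Q (0 + 1) = ∅ := by
        refine ratios_add_one_eq_empty hm hs01 hs02 hs12 ?_
        rw [zero_add, zero_add, q0, q1, q2]
        have : b * m 1 ≤ b / β * m 2 := by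
          rw [div_mul_eq_mul_div, le_div_iff₀ hβ]
          nlinarith
        linarith
      have e2 : ratios m Q (0 + 2) = {t | IsEulerRatio (m 0) (m 2) (m 1) β 1 (-b) t} := by
        ext t
        rw [Set.mem_ofPred_eq, ← isEulerRatio_smul_iff hbβ]
        simp only [ratios, add_two_add_one, add_two_add_two, Set.mem_ofPred_eq]
        rw [zero_add, zero_add, q0, q1, q2]
        have a1 : b / β * β = -(-1 * b) := by field_simp
        have a2 : b / β * 1 = -(-1 * (b / β)) := by ring
        have a3 : b / β * -b = -(b * (b / β)) := by ring
        rw [a1, a2, a3]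
      have e0 : (ratios m Q 0).encard = 1 := by
        refine le_antisymm (encard_ratios_le_one hm hs12.le) ?_
        rw [Set.one_le_encard_iff_nonempty]
        obtain ⟨t, ht⟩ := exists_isEulerRatio h1 h0 h2 hb0 hb1 hβ
        refine ⟨t, ?_⟩
        rw [← isEulerRatio_smul_iff hbβ] at ht
        simp only [ratios, Set.mem_ofPred_eq]
        rw [zero_add, zero_add, q0, q1, q2]
        have a1 : b / β * 1 = -(b / β * -1) := by ring
        have a2 : b / β * -b = -(b / β * b) := by ring
        have a3 : b / β * β = -(-1 * b) := by field_simp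
        rwa [a1, a2, a3] at ht
      rw [encard_collinearClasses_eq_add hm Q 0, e0, e1, e2, hb, Set.encard_empty, zero_add,
        Nat.cast_add, Nat.cast_one, add_comm]

end ThreeBody

end

theorem mainTheorem7 (m : Fin 3 → ℝ) (hm : ∀ i, 0 < m i) :
    -- up to similarity there are zero, one, two or three collinear ones, whatever the charges
    (∀ Q : Fin 3 → ℝ,
      (ThreeBody.collinearClasses m Q).encard = 0 ∨ (ThreeBody.collinearClasses m Q).encard = 1 ∨
      (ThreeBody.collinearClasses m Q).encard = 2 ∨
      (ThreeBody.collinearClasses m Q).encard = 3) ∧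
    -- each of these numbers occurs for suitable charges
    (∀ n : ℕ, n ≤ 3 → ∃ Q : Fin 3 → ℝ, (∀ i, Q i ≠ 0) ∧
      (ThreeBody.collinearClasses m Q).encard = n) ∧
    -- there are no non-collinear ones
    (∀ Q : Fin 3 → ℝ, ∀ z : ThreeBody.Phase,
      ThreeBody.IsAssociatedToCentral m Q z → ThreeBody.IsCollinear z.1) ∧
    -- unless the potential vanishes, a non-collinear central configuration has a negative
    -- multiplier and is not the projection of any critical point of the integral map
    (∀ Q : Fin 3 → ℝ, (∃ i j, i ≠ j ∧ Q i ≠ 0 ∧ Q j ≠ 0) →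
      ∀ q : ThreeBody.Config, ¬ ThreeBody.IsCollinear q →
        (∀ lam : ℝ, ThreeBody.IsCentralWith m Q q lam → lam < 0) ∧
        (ThreeBody.IsCentral m Q q →
          ∀ p : ThreeBody.Config, ¬ ThreeBody.IsCriticalPoint m Q (q, p))) := by
  refine ⟨fun Q => ?_, fun n hn => ThreeBody.exists_encard_collinearClasses hm n hn,
    fun Q z hz => hz.isCollinear hm, fun Q hQ q hq =>
      ⟨fun lam h => h.neg_of_not_isCollinear hm hq hQ, fun h p =>
        ThreeBody.not_isCriticalPoint_of_isCentral hm hQ hq h p⟩⟩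
  have h := ThreeBody.encard_collinearClasses_le_three hm Q
  obtain ⟨n, hn⟩ := ENat.ne_top_iff_exists.mp (h.trans_lt (by decide)).ne
  rw [← hn] at h ⊢
  have h3 : n ≤ 3 := by exact_mod_cast h
  interval_cases n <;> simp
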